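/- Conventions. Rings are associative with $1$. A topological ring is a ring with a topology making addition, negation and multiplication continuous; a topological left module $M$ over a topological ring $R$ is a topological abelian group with a continuous action $R\times M\to M$ (similarly on the right; right $R$-modules are left $R^{\mathrm{op}}$-modules). A topological module is *linearly topologized* if the submodules that are neighbourhoods of $0$ form a neighbourhood basis of $0$; $R$ is left (right) linearly topologized if ${}_RR$ (resp. $R_R$) is. A topological module is *pseudocompact* if it is Hausdorff, complete, and has a neighbourhood basis of $0$ consisting of open submodules $N$ with $M/N$ of finite length; it is *linearly compact* if it is linearly topologized, Hausdorff, and every family of closed cosets of submodules with the finite intersection property has nonempty intersection. ${}_R\mathrm{TMod}$ is the category of topological left $R$-modules and continuous homomorphisms, and ${}_R\mathrm{PC}$ its full subcategory of pseudocompact modules. $R$ is *left pseudocompact* if ${}_RR$ is pseudocompact; *linearly compact* if both ${}_RR$ and $R_R$ are linearly compact; *pro-discrete* if it is Hausdorff, complete, and has a neighbourhood basis of $0$ consisting of two-sided ideals; *pseudocompact* if it is Hausdorff, complete, and has a neighbourhood basis of $0$ consisting of open two-sided ideals $I$ such that $R/I$ has finite length both as a left and as a right module. $R$ is *left pseudocompact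 semisimple* if ${}_RR$ is isomorphic in ${}_R\mathrm{TMod}$ to a product of simple discrete modules. $J(R)$ is the Jacobson radical and $J_0(R)$ is the intersection of all open maximal left ideals. **Theorem.** Let $R$ be a topological ring. The following assertions are equivalent: (a) $R \cong \prod_{i\in I} S_i^{\,n_i}$ in ${}_R\mathrm{TMod}$ for some pairwise non-isomorphic discrete simple left $R$-modules $S_i$ and integers $n_i\ge 1$; (b) $R$ is pseudocompact and ${}_RR$ is a coproduct of simple objects in the category ${}_R\mathrm{PC}$; (c) $R\cong\prod_{i} M_{n_i}(D_i)$ as topological rings for some division rings $D_i$ and integers $n_i\ge 1$, where each matrix ring is discrete and the product has the product topology; (d) $R$ is pro-discrete and every open left ideal has a complement; (d$'$) $R$ is pro-discrete and every closed left ideal has a closed complement; (e) $R$ is left pseudocompact semisimple and right linearly topologized; (e$'$) $R$ is left pseudocompact, $J(R)=0$, and $R$ is right linearly topologized; (f) $R$ is pseudocompact and $J(R)=0$; (f$'$) $R$ is pseudocompact and $J_0(R)=0$; (g) $R$ is linearly compact and $J(R)=0$; (g$'$) $R$ is linearly compact and $J_0(R)=0$; (h) any one of the statements obtained from (a), (b),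 (d), (d$'$), (e), (e$'$) by exchanging left and right (each of these six statements is separately equivalent to the others). -/

import Mathlib

open Topology CategoryTheory CategoryTheory.Limits

universe u

section Modules

/-- Completeness of a topological abelian group: every Cauchy filter (equivalently, Cauchy net)
for its canonical uniform structure converges. -/
def IsCompleteGroup (M : Type*) [AddCommGroup M] [TopologicalSpace M]
    [IsTopologicalAddGroup M] : Prop :=
  letI : UniformSpace M := IsTopologicalAddGroup.rightUniformSpace M
  CompleteSpace M

/-- A pseudocompact topological module: Hausdorff, complete, with a neighbourhood basis of `0`
consisting of open submodules of finite colength. -/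
structure IsPseudocompactModule (R M : Type*) [Ring R] [AddCommGroup M] [Module R M]
    [TopologicalSpace M] [IsTopologicalAddGroup M] : Prop where
  t2 : T2Space M
  complete : IsCompleteGroup M
  basis : ∀ U ∈ 𝓝 (0 : M), ∃ N : Submodule R M,
    IsOpen (N : Set M) ∧ IsFiniteLength R (M ⧸ N) ∧ (N : Set M) ⊆ U

/-- A linearly compact topological module: linearly topologized, Hausdorff, and every family of
closed cosets of submodules with the finite intersection property has nonempty intersection. -/
structure IsLinearlyCompactModule (R M : Type*) [Ring R] [AddCommGroup M] [Module R M]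
    [TopologicalSpace M] [IsTopologicalAddGroup M] : Prop where
  linear : IsLinearTopology R M
  t2 : T2Space M
  inter_nonempty : ∀ F : Set (Set M),
    (∀ C ∈ F, IsClosed C ∧ ∃ (x : M) (N : Submodule R M), C = {y | y - x ∈ N}) →
    (∀ G ⊆ F, G.Finite → (⋂₀ G).Nonempty) → (⋂₀ F).Nonempty

/-- Every open submodule of `M` has a complement, i.e. is a direct summand. -/
def OpenSubmodulesComplemented (R M : Type*) [Ring R] [AddCommGroup M] [Module R M]
    [TopologicalSpace M] : Prop :=
  ∀ N : Submodule R M, IsOpen (N : Set M) → ∃ N' : Submodule R M, IsCompl N N'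

/-- Every closed submodule of `M` has a closed complement. -/
def ClosedSubmodulesComplemented (R M : Type*) [Ring R] [AddCommGroup M] [Module R M]
    [TopologicalSpace M] : Prop :=
  ∀ N : Submodule R M, IsClosed (N : Set M) →
    ∃ N' : Submodule R M, IsClosed (N' : Set M) ∧ IsCompl N N'

/-- As a topological module, `M` is a product (with the product topology) of simple discrete
topological `R`-modules. -/
def IsProductOfSimpleDiscrete (R M : Type u) [Ring R] [TopologicalSpace R] [AddCommGroup M]
    [Module R M] [TopologicalSpace M] : Prop :=
  ∃ (I : Type u) (S : I → TopModuleCat.{u} R),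
    (∀ i, DiscreteTopology (S i)) ∧ (∀ i, IsSimpleModule R (S i)) ∧
    Nonempty (M ≃L[R] (∀ i, S i))

/-- As a topological module, `M` is a product `∏ i, S i ^ n i` (with the product topology) of
finite powers, with exponents `n i ≥ 1`, of pairwise non-isomorphic simple discrete topological
`R`-modules `S i`. -/
def IsProductOfIsotypicPowers (R M : Type u) [Ring R] [TopologicalSpace R] [AddCommGroup M]
    [Module R M] [TopologicalSpace M] : Prop :=
  ∃ (I : Type u) (S : I → TopModuleCat.{u} R) (n : I → ℕ),
    (∀ i, DiscreteTopology (S i)) ∧ (∀ i, IsSimpleModule R (S i)) ∧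
    (∀ i j, i ≠ j → IsEmpty (S i ≅ S j)) ∧ (∀ i, 1 ≤ n i) ∧
    Nonempty (M ≃L[R] (∀ i, Fin (n i) → S i))

end Modules

section Category

variable (R : Type u) [Ring R] [TopologicalSpace R]

/-- The pseudocompact objects in the category of topological `R`-modules. -/
def isPseudocompactObj : ObjectProperty (TopModuleCat.{u} R) :=
  fun M => IsPseudocompactModule R M

/-- The category of pseudocompact topological `R`-modules, a full subcategory of the category of
topological `R`-modules and continuous homomorphisms. -/
abbrev PseudocompactCat : Type (u + 1) := (isPseudocompactObj R).FullSubcategory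

/-- A pseudocompact topological module as an object of the category of those. -/
def PseudocompactCat.of (M : Type u) [AddCommGroup M] [Module R M] [TopologicalSpace M]
    [IsTopologicalAddGroup M] [ContinuousSMul R M] (h : IsPseudocompactModule R M) :
    PseudocompactCat R :=
  ⟨TopModuleCat.of R M, h⟩

variable {R} in
/-- `P` is a coproduct, in the category of pseudocompact modules, of simple objects of that
category. -/
def IsCoproductOfSimples (P : PseudocompactCat R) : Prop :=
  ∃ (J : Type u) (L : J → PseudocompactCat R) (ι : ∀ j, L j ⟶ P),
    (∀ j, Simple (L j)) ∧ Nonempty (IsColimit (Cofan.mk P ι))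

end Category

/-! For a ring `R`, the left module `R` is `R` over `R`, and the right module `R` is `R` over
`Rᵐᵒᵖ`. Thus left ideals are terms of `Submodule R R` (that is, `Ideal R`), and right ideals are
terms of `Submodule Rᵐᵒᵖ R`. -/

section Rings

variable (R : Type u) [Ring R] [TopologicalSpace R] [IsTopologicalRing R]

/-- A pro-discrete ring: Hausdorff, complete, with a neighbourhood basis of `0` consisting of
(open) two-sided ideals. -/
structure IsProdiscreteRing : Prop where
  t2 : T2Space R
  complete : IsCompleteGroup R
  basis : ∀ U ∈ 𝓝 (0 : R), ∃ I : TwoSidedIdeal R, IsOpen (I : Set R) ∧ (I : Set R) ⊆ U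

/-- A (two-sided) pseudocompact ring: Hausdorff, complete, with a neighbourhood basis of `0`
consisting of (open) two-sided ideals `I` such that `R/I` has finite length both as a left and as
a right `R`-module. The two-sided ideal is given as a left ideal `I` and a right ideal `J` that
are the same subset of `R`. -/
structure IsPseudocompactRing : Prop where
  t2 : T2Space R
  complete : IsCompleteGroup R
  basis : ∀ U ∈ 𝓝 (0 : R), ∃ (I : Submodule R R) (J : Submodule Rᵐᵒᵖ R),
    (I : Set R) = (J : Set R) ∧ IsOpen (I : Set R) ∧
    IsFiniteLength R (R ⧸ I) ∧ IsFiniteLength Rᵐᵒᵖ (R ⧸ J) ∧ (I : Set R) ⊆ U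

variable {R} in
theorem IsPseudocompactRing.left (h : IsPseudocompactRing R) : IsPseudocompactModule R R where
  t2 := h.t2
  complete := h.complete
  basis U hU := by
    obtain ⟨I, J, -, ho, hl, -, hs⟩ := h.basis U hU
    exact ⟨I, ho, hl, hs⟩

variable {R} in
theorem IsPseudocompactRing.right (h : IsPseudocompactRing R) :
    IsPseudocompactModule Rᵐᵒᵖ R where
  t2 := h.t2
  complete := h.complete
  basis U hU := by
    obtain ⟨I, J, e, ho, -, hr, hs⟩ := h.basis U hU
    exact ⟨J, e ▸ ho, hr, e ▸ hs⟩

/-- A linearly compact ring: both left and right linearly compact. -/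
def IsLinearlyCompactRing : Prop :=
  IsLinearlyCompactModule R R ∧ IsLinearlyCompactModule Rᵐᵒᵖ R

/-- The topological Jacobson radical `J₀(R)`: the intersection of all open maximal left ideals. -/
def topJacobson : Ideal R := sInf {I : Ideal R | I.IsMaximal ∧ IsOpen (I : Set R)}

/-- As a topological ring, `R` is isomorphic to a product `∏ i, M_{n i}(D i)` of matrix rings over
division rings with `n i ≥ 1`, with the product topology of the discrete topologies. -/
def IsProductOfDiscreteMatrixRings : Prop :=
  ∃ (I : Type u) (n : I → ℕ) (D : I → Type u) (_ : ∀ i, DivisionRing (D i)),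
    (∀ i, 1 ≤ n i) ∧
    letI : ∀ i, TopologicalSpace (Matrix (Fin (n i)) (Fin (n i)) (D i)) := fun _ => ⊥
    ∃ e : R ≃+* (∀ i, Matrix (Fin (n i)) (Fin (n i)) (D i)), IsHomeomorph e

/-- A left pseudocompact semisimple ring: as a left topological module, `R` is a product of simple
discrete left modules. -/
def IsLeftPseudocompactSemisimple : Prop := IsProductOfSimpleDiscrete R R

/-- A right pseudocompact semisimple ring: as a right topological module, `R` is a product of
simple discrete right modules. -/
def IsRightPseudocompactSemisimple : Prop := IsProductOfSimpleDiscrete Rᵐᵒᵖ R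

end Rings

/-! Every statement is compared with one left-right symmetric notion, `IsProsemisimpleRing`:
complete, Hausdorff, with arbitrarily small open ideals whose quotient rings are semisimple.

To reach it, small open left ideals with semisimple quotient module suffice, provided right
multiplications are equicontinuous at zero (`IsProsemisimpleRing.of_left_ideals`). Equicontinuity
comes from a right linear topology, or, in (a), from the absence of nonzero maps between
non-isomorphic simple modules. Semisimple quotients are visible in a product of simples; they follow
from complements, and for coproducts from testing the universal property on discrete quotients. When
a radical vanishes they come from linear compactness, which pseudocompactness implies: a maximal
coindependent family of open maximal left ideals makes `R` behave like a product of simple modules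
(`IsLinearlyCompactModule.isSemisimpleModule_quotient`). Over a linearly compact ring `J₀ ≤ J`, and
`J ≤ J₀` always, so both radicals serve.

Conversely, a prosemisimple ring is pseudocompact on both sides, hence linearly compact. The Chinese
remainder theorem then extends to infinitely many congruences and exhibits `R` as the product of its
discrete simple Artinian quotients (`IsProsemisimpleRing.exists_simple_quotients`); Wedderburn–Artin
gives (c) and (a). In (b), a cocone is descended by sending `1` to a convergent sum. Right-handed
statements are obtained through the opposite ring. -/

open Filter MulOpposite

/-! ### Completeness of topological abelian groups -/

section Completeness

variable {M N : Type*} [AddCommGroup M] [TopologicalSpace M] [IsTopologicalAddGroup M]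
  [AddCommGroup N] [TopologicalSpace N] [IsTopologicalAddGroup N]

/-- Removes the uniform structure, so that completeness can be handled with neighbourhoods of zero
alone. -/
theorem isCompleteGroup_iff : IsCompleteGroup M ↔ ∀ f : Filter M, f.NeBot →
    (∀ U ∈ 𝓝 (0 : M), ∃ s ∈ f, ∀ x ∈ s, ∀ y ∈ s, y - x ∈ U) → ∃ a, f ≤ 𝓝 a := by
  unfold IsCompleteGroup
  let : UniformSpace M := IsTopologicalAddGroup.rightUniformSpace M
  have key : ∀ f : Filter M, Cauchy f ↔
      f.NeBot ∧ ∀ U ∈ 𝓝 (0 : M), ∃ s ∈ f, ∀ x ∈ s, ∀ y ∈ s, y - x ∈ U := by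
    intro f
    rw [cauchy_iff]
    refine and_congr_right fun _ => ?_
    rw [uniformity_eq_comap_nhds_zero' M]
    constructor
    · intro h U hU
      obtain ⟨t, ht, hs⟩ := h _ (preimage_mem_comap hU)
      refine ⟨t, ht, fun x hx y hy => ?_⟩
      have := hs (Set.mk_mem_prod hx hy)
      simpa [sub_eq_add_neg] using this
    · rintro h s ⟨U, hU, hs⟩
      obtain ⟨t, ht, htU⟩ := h U hU
      refine ⟨t, ht, ?_⟩
      rintro ⟨x, y⟩ ⟨hx, hy⟩
      apply hs
      simpa [sub_eq_add_neg] using htU x hx y hy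
  constructor
  · intro h f hf hU
    exact h.complete ((key f).2 ⟨hf, hU⟩)
  · intro h
    exact ⟨fun {f} hf => h f ((key f).1 hf).1 ((key f).1 hf).2⟩

theorem IsCompleteGroup.of_discreteTopology [DiscreteTopology M] : IsCompleteGroup M := by
  rw [isCompleteGroup_iff]
  intro f hf h
  obtain ⟨s, hs, hsub⟩ := h {0} (by simp)
  obtain ⟨a, ha⟩ := hf.nonempty_of_mem hs
  refine ⟨a, ?_⟩
  rw [nhds_discrete, le_pure_iff]
  refine mem_of_superset hs fun y hy => ?_
  simpa [sub_eq_zero] using hsub a ha y hy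

theorem IsCompleteGroup.of_isInducing (h : IsCompleteGroup N) (e : M →+ N)
    (he : IsInducing e) (hc : IsClosed (Set.range e)) : IsCompleteGroup M := by
  rw [isCompleteGroup_iff] at h ⊢
  intro f hf hU
  obtain ⟨b, hb⟩ := h (f.map e) inferInstance (by
    intro U hU'
    obtain ⟨s, hs, hsU⟩ := hU (e ⁻¹' U) (he.continuous.continuousAt.preimage_mem_nhds
      (by simpa using hU'))
    refine ⟨e '' s, image_mem_map hs, ?_⟩
    rintro _ ⟨x, hx, rfl⟩ _ ⟨y, hy, rfl⟩
    simpa using hsU x hx y hy)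
  obtain ⟨a, rfl⟩ : b ∈ Set.range e := by
    rw [← hc.closure_eq]
    exact mem_closure_of_tendsto (f := e) (b := f) hb (Eventually.of_forall fun x => ⟨x, rfl⟩)
  exact ⟨a, by rw [he.nhds_eq_comap]; exact map_le_iff_le_comap.1 hb⟩

theorem IsCompleteGroup.of_homeomorph (h : IsCompleteGroup N) (e : M ≃+ N)
    (he : IsHomeomorph e) : IsCompleteGroup M :=
  h.of_isInducing e.toAddMonoidHom he.isInducing
    (by simp [show Set.range (e : M → N) = Set.univ from e.surjective.range_eq])

theorem IsCompleteGroup.pi {I : Type*} {X : I → Type*} [∀ i, AddCommGroup (X i)]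
    [∀ i, TopologicalSpace (X i)] [∀ i, IsTopologicalAddGroup (X i)]
    (h : ∀ i, IsCompleteGroup (X i)) : IsCompleteGroup (∀ i, X i) := by
  simp_rw [isCompleteGroup_iff] at h ⊢
  intro f hf hU
  have : ∀ i, ∃ a, f.map (fun x => x i) ≤ 𝓝 a := by
    intro i
    refine h i _ inferInstance fun U hU' => ?_
    obtain ⟨s, hs, hsU⟩ := hU ((fun x => x i) ⁻¹' U)
      ((continuous_apply i).continuousAt.preimage_mem_nhds (by simpa using hU'))
    refine ⟨_, image_mem_map hs, ?_⟩
    rintro _ ⟨x, hx, rfl⟩ _ ⟨y, hy, rfl⟩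
    simpa using hsU x hx y hy
  choose a ha using this
  exact ⟨a, (tendsto_pi_nhds.2 ha : Tendsto id f (𝓝 a))⟩

end Completeness

/-! ### Maximal families of cosets with the finite intersection property -/

section Cosets

variable {R M : Type*} [Ring R] [AddCommGroup M] [Module R M]

/-- A family of cosets of submodules with the finite intersection property is contained in a
family of the same kind which, for every submodule of finite colength, contains one of its
cosets. -/
theorem exists_fip_coset_family_superset (F : Set (Set M))
    (hF : ∀ C ∈ F, ∃ (x : M) (N : Submodule R M), C = {y | y - x ∈ N})
    (hfip : ∀ G ⊆ F, G.Finite → (⋂₀ G).Nonempty) :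
    ∃ F' : Set (Set M), F ⊆ F' ∧ (∀ G ⊆ F', G.Finite → (⋂₀ G).Nonempty) ∧
      ∀ N : Submodule R M, IsArtinian R (M ⧸ N) → ∃ x : M, {y | y - x ∈ N} ∈ F' := by
  let S : Set (Set (Set M)) := {F | (∀ C ∈ F, ∃ (x : M) (N : Submodule R M), C = {y | y - x ∈ N}) ∧
    ∀ G ⊆ F, G.Finite → (⋂₀ G).Nonempty}
  obtain ⟨F', hFF', hmax⟩ := zorn_subset_nonempty S (by
    rintro c hc hchain ⟨c0, hc0⟩
    refine ⟨⋃₀ c, ⟨?_, ?_⟩, fun s hs => Set.subset_sUnion_of_mem hs⟩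
    · rintro C ⟨F, hF, hC⟩
      exact (hc hF).1 C hC
    · intro G hG hfin
      obtain ⟨F, hF, hGF⟩ := DirectedOn.exists_mem_subset_of_finite_of_subset_sUnion
        ⟨c0, hc0⟩ hchain.directedOn hfin hG
      exact (hc hF).2 G hGF hfin) F ⟨hF, hfip⟩
  refine ⟨F', hFF', hmax.prop.2, fun N hN => ?_⟩
  -- finite intersections are cosets
  have hcos : ∀ G ⊆ F', G.Finite → ∃ (x : M) (L : Submodule R M), ⋂₀ G = {y | y - x ∈ L} := by
    intro G hG hfin
    obtain ⟨x, hx⟩ := hmax.prop.2 G hG hfin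
    have : ∀ C : G, ∃ L : Submodule R M, C.1 = {y | y - x ∈ L} := by
      rintro ⟨C, hC⟩
      obtain ⟨z, L, rfl⟩ := hmax.prop.1 C (hG hC)
      have hxz : x - z ∈ L := hx _ hC
      refine ⟨L, Set.ext fun y => ?_⟩
      constructor
      · intro hy
        simpa using L.sub_mem hy hxz
      · intro hy
        simpa using L.add_mem hy hxz
    choose L hL using this
    refine ⟨x, ⨅ C, L C, Set.ext fun y => ?_⟩
    simp only [Set.mem_sInter, Set.mem_ofPred_eq, Submodule.mem_iInf]
    constructor
    · intro h C
      have := h C.1 C.2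
      rw [hL C] at this
      exact this
    · intro h C hC
      rw [show C = _ from hL ⟨C, hC⟩]
      exact h ⟨C, hC⟩
  -- Since `M ⧸ N` is Artinian, some finite intersection has a direction with minimal image there.
  -- Intersecting further cannot shrink this image, so every finite intersection meets the coset `x
  -- + N`, which maximality then puts into the family.
  let T : Set (Submodule R (M ⧸ N)) := {Q | ∃ G ⊆ F', G.Finite ∧ ∃ (x : M) (L : Submodule R M),
    ⋂₀ G = {y | y - x ∈ L} ∧ Q = L.map N.mkQ}
  obtain ⟨Q, ⟨G, hG, hGfin, x, L, hGL, rfl⟩, hmin⟩ := WellFounded.has_min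
    (wellFounded_lt (α := Submodule R (M ⧸ N))) T (by
      obtain ⟨x, L, h⟩ := hcos ∅ (by simp) (by simp)
      exact ⟨_, ∅, by simp, by simp, x, L, h, rfl⟩)
  have hxG : x ∈ ⋂₀ G := by rw [hGL]; simp
  have hmeet : ∀ G' ⊆ F', G'.Finite → ∃ z ∈ ⋂₀ G', z - x ∈ N := by
    intro G' hG' hfin'
    obtain ⟨x', L', hL'⟩ := hcos (G ∪ G') (Set.union_subset hG hG') (hGfin.union hfin')
    have hx' : x' ∈ ⋂₀ (G ∪ G') := by rw [hL']; simp
    have hx'G : x' - x ∈ L := by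
      have : x' ∈ ⋂₀ G := fun C hC => hx' C (Or.inl hC)
      rwa [hGL] at this
    have hle : L' ≤ L := by
      intro l hl
      have h1 : x' + l ∈ ⋂₀ (G ∪ G') := by rw [hL']; simpa
      have h2 : x' + l ∈ ⋂₀ G := fun C hC => h1 C (Or.inl hC)
      rw [hGL] at h2
      have := L.sub_mem h2 hx'G
      simpa using this
    have heq : L'.map N.mkQ = L.map N.mkQ := by
      refine ((Submodule.map_mono hle).lt_or_eq.resolve_left fun hlt => ?_)
      exact hmin _ ⟨G ∪ G', Set.union_subset hG hG', hGfin.union hfin', x', L', hL', rfl⟩ hlt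
    have : N.mkQ (x - x') ∈ L'.map N.mkQ := by
      rw [heq]
      exact Submodule.mem_map_of_mem (by simpa using L.neg_mem hx'G)
    obtain ⟨l, hl, hl'⟩ := this
    have hl2 : l - (x - x') ∈ N := by
      rwa [← sub_eq_zero, ← map_sub, Submodule.mkQ_apply, Submodule.Quotient.mk_eq_zero] at hl'
    refine ⟨x' + l, ?_, ?_⟩
    · have h1 : x' + l ∈ ⋂₀ (G ∪ G') := by rw [hL']; simpa
      exact fun C hC => h1 C (Or.inr hC)
    · convert hl2 using 1; abel
  refine ⟨x, ?_⟩
  by_contra hnot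
  have hins : insert {y | y - x ∈ N} F' ∈ S := by
    refine ⟨?_, ?_⟩
    · rintro C (rfl | hC)
      · exact ⟨x, N, rfl⟩
      · exact hmax.prop.1 C hC
    · intro G' hG' hfin'
      obtain ⟨z, hz, hzN⟩ := hmeet (G' \ {{y | y - x ∈ N}})
        (by rintro C ⟨hC, hne⟩; exact (hG' hC).resolve_left hne) hfin'.sdiff
      refine ⟨z, fun C hC => ?_⟩
      by_cases hCe : C = {y | y - x ∈ N}
      · rw [hCe]; exact hzN
      · exact hz C ⟨hC, hCe⟩
  exact hnot (hmax.le_of_ge hins (Set.subset_insert _ _) (Set.mem_insert _ _))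

end Cosets

/-! ### Pseudocompact, linearly compact and complete modules -/

section LinearlyCompact

variable {R M : Type*} [Ring R] [AddCommGroup M] [Module R M] [TopologicalSpace M]
  [IsTopologicalAddGroup M]

theorem Submodule.isOpen_of_le {N N' : Submodule R M} (h : N ≤ N') (hN : IsOpen (N : Set M)) :
    IsOpen (N' : Set M) :=
  AddSubgroup.isOpen_mono (H₁ := N.toAddSubgroup) (H₂ := N'.toAddSubgroup) h hN

theorem Submodule.isClosed_of_isOpen {N : Submodule R M} (hN : IsOpen (N : Set M)) :
    IsClosed (N : Set M) :=
  AddSubgroup.isClosed_of_isOpen N.toAddSubgroup hN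

theorem Submodule.isClosed_coset {N : Submodule R M} (hN : IsClosed (N : Set M)) (x : M) :
    IsClosed {y | y - x ∈ N} :=
  hN.preimage (continuous_id.sub continuous_const)

theorem IsPseudocompactModule.isLinearTopology (h : IsPseudocompactModule R M) :
    IsLinearTopology R M where
  hasBasis_submodule' := ⟨fun U => ⟨fun hU => by
    obtain ⟨N, ho, -, hs⟩ := h.basis U hU
    exact ⟨N, ho.mem_nhds N.zero_mem, hs⟩, fun ⟨N, hN, hs⟩ => mem_of_superset hN hs⟩⟩

theorem exists_open_submodule_subset [IsLinearTopology R M] {U : Set M} (hU : U ∈ 𝓝 (0 : M)) :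
    ∃ N : Submodule R M, IsOpen (N : Set M) ∧ (N : Set M) ⊆ U :=
  (IsLinearTopology.hasBasis_open_submodule R).mem_iff.1 hU

theorem IsFiniteLength.isArtinian' {X : Type*} [AddCommGroup X] [Module R X]
    (h : IsFiniteLength R X) : IsArtinian R X :=
  (isFiniteLength_iff_isNoetherian_isArtinian.1 h).2

/-- An enlarged family containing a coset of each open submodule of finite colength generates a
Cauchy filter; its limit lies in every closed member of the original family. -/
theorem IsPseudocompactModule.isLinearlyCompactModule (h : IsPseudocompactModule R M) :
    IsLinearlyCompactModule R M where
  linear := h.isLinearTopology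
  t2 := h.t2
  inter_nonempty F hF hfip := by
    obtain ⟨F', hFF', hfip', hcos⟩ := exists_fip_coset_family_superset (R := R) F
      (fun C hC => (hF C hC).2) hfip
    have hnb : (Filter.generate F').NeBot := generate_neBot_iff.2 hfip'
    obtain ⟨a, ha⟩ := isCompleteGroup_iff.1 h.complete (Filter.generate F') hnb (by
      intro U hU
      obtain ⟨N, ho, hl, hs⟩ := h.basis U hU
      obtain ⟨x, hx⟩ := hcos N hl.isArtinian'
      refine ⟨_, mem_generate_of_mem hx, fun y hy z hz => hs ?_⟩
      simpa using N.sub_mem hz hy)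
    refine ⟨a, fun C hC => ?_⟩
    have hCm : C ∈ Filter.generate F' := mem_generate_of_mem (hFF' hC)
    rw [← (hF C hC).1.closure_eq]
    exact mem_closure_of_tendsto (f := id) (b := Filter.generate F') ha hCm

/-- The cosets of open submodules belonging to a Cauchy filter have a common point, and any such
point is a limit. -/
theorem IsLinearlyCompactModule.isCompleteGroup (h : IsLinearlyCompactModule R M) :
    IsCompleteGroup M := by
  have := h.linear
  rw [isCompleteGroup_iff]
  intro f hf hU
  let F : Set (Set M) := {C | C ∈ f ∧ ∃ (x : M) (N : Submodule R M), IsOpen (N : Set M) ∧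
    C = {y | y - x ∈ N}}
  obtain ⟨a, ha⟩ := h.inter_nonempty F
    (by
      rintro C ⟨-, x, N, hN, rfl⟩
      exact ⟨Submodule.isClosed_coset (Submodule.isClosed_of_isOpen hN) x, x, N, rfl⟩)
    (fun G hG hfin => hf.nonempty_of_mem ((sInter_mem hfin).2 fun C hC => (hG hC).1))
  refine ⟨a, fun U hUa => ?_⟩
  have hU0 : (fun x => x + a) ⁻¹' U ∈ 𝓝 (0 : M) :=
    (continuous_id.add continuous_const).continuousAt.preimage_mem_nhds (by simpa using hUa)
  obtain ⟨N, hN, hNU⟩ := exists_open_submodule_subset (R := R) hU0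
  obtain ⟨s, hs, hsN⟩ := hU N (hN.mem_nhds N.zero_mem)
  obtain ⟨x, hx⟩ := hf.nonempty_of_mem hs
  have hC : {y | y - x ∈ N} ∈ f := mem_of_superset hs fun y hy => hsN x hx y hy
  have hax : a - x ∈ N := ha _ ⟨hC, x, N, hN, rfl⟩
  refine mem_of_superset hC fun y hy => ?_
  have := hNU (show y - a ∈ N by simpa using N.sub_mem hy hax)
  simpa using this

end LinearlyCompact

/-! ### Coindependent families of submodules -/

section Coindependent

variable {R M : Type*} [Ring R] [AddCommGroup M] [Module R M]

/-- A set of submodules is coindependent if any finitely many congruences modulo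
distinct members can be solved simultaneously. -/
def Coindependent (B : Set (Submodule R M)) : Prop :=
  ∀ F : Finset (Submodule R M), (F : Set (Submodule R M)) ⊆ B →
    ∀ y : Submodule R M → M, ∃ x, ∀ m ∈ F, x - y m ∈ m

theorem Coindependent.empty : Coindependent (∅ : Set (Submodule R M)) := by
  intro F hF y
  exact ⟨0, fun m hm => (hF hm).elim⟩

/-- Maximality gives `m ⊔ sInf B = ⊤`, so a solution for members of `B` can be corrected modulo `m`
by an element of `sInf B`. -/
theorem Coindependent.insert {B : Set (Submodule R M)} (hB : Coindependent B)
    {m : Submodule R M} (hm : IsCoatom m) (h : ¬ sInf B ≤ m) : Coindependent (insert m B) := by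
  classical
  intro F hF y
  obtain ⟨x, hx⟩ := hB (F.erase m) (fun m' hm' => by
    have h' := Finset.mem_erase.1 hm'
    exact (hF h'.2).resolve_left h'.1) y
  have htop : m ⊔ sInf B = ⊤ := hm.2 _ (lt_of_le_of_ne le_sup_left fun he => h (by
    rw [he]; exact le_sup_right))
  obtain ⟨p, hp, k, hk, hpk⟩ := Submodule.mem_sup.1 (htop ▸ Submodule.mem_top : y m - x ∈ m ⊔ sInf B)
  refine ⟨x + k, fun m' hm' => ?_⟩
  by_cases he : m' = m
  · subst he
    have : x + k - y m' = -p := by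
      rw [← sub_eq_zero, ← sub_eq_zero.2 hpk]; abel
    rw [this]
    exact m'.neg_mem hp
  · have h1 := hx m' (Finset.mem_erase.2 ⟨he, hm'⟩)
    have h2 : k ∈ m' := (Submodule.mem_sInf.1 hk) m' ((hF hm').resolve_left he)
    convert m'.add_mem h1 h2 using 1
    abel

/-- Zorn: a member of `T` not containing `sInf B` could still be added to `B`. Starting from a
prescribed `A` is what later produces complements. -/
theorem Coindependent.exists_maximal {T A : Set (Submodule R M)} (hT : ∀ m ∈ T, IsCoatom m)
    (hA : Coindependent A) (hAT : A ⊆ T) :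
    ∃ B, A ⊆ B ∧ B ⊆ T ∧ Coindependent B ∧ sInf B = sInf T := by
  obtain ⟨B, hAB, hmax⟩ := zorn_subset_nonempty {B : Set (Submodule R M) | B ⊆ T ∧ Coindependent B}
    (by
      rintro c hc hchain ⟨c0, hc0⟩
      refine ⟨⋃₀ c, ⟨Set.sUnion_subset fun B hB => (hc hB).1, ?_⟩,
        fun s hs => Set.subset_sUnion_of_mem hs⟩
      intro F hF y
      obtain ⟨B, hB, hFB⟩ := DirectedOn.exists_mem_subset_of_finite_of_subset_sUnion
        ⟨c0, hc0⟩ hchain.directedOn F.finite_toSet hF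
      exact (hc hB).2 F hFB y) A ⟨hAT, hA⟩
  refine ⟨B, hAB, hmax.prop.1, hmax.prop.2, le_antisymm (le_sInf fun m hm => ?_)
    (sInf_le_sInf hmax.prop.1)⟩
  by_contra h
  exact h (sInf_le (hmax.le_of_ge
    ⟨Set.insert_subset hm hmax.prop.1, hmax.prop.2.insert (hT m hm) h⟩
    (Set.subset_insert _ _) (Set.mem_insert _ _)))

variable [TopologicalSpace M] [IsTopologicalAddGroup M]

theorem Coindependent.exists_forall_sub_mem (hM : IsLinearlyCompactModule R M)
    {B : Set (Submodule R M)} (hB : Coindependent B) (hcl : ∀ m ∈ B, IsClosed (m : Set M))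
    (y : Submodule R M → M) : ∃ x, ∀ m ∈ B, x - y m ∈ m := by
  classical
  obtain ⟨x, hx⟩ := hM.inter_nonempty ((fun m : Submodule R M => {z | z - y m ∈ m}) '' B)
    (by
      rintro _ ⟨m, hm, rfl⟩
      exact ⟨Submodule.isClosed_coset (hcl m hm) _, _, m, rfl⟩)
    (by
      intro G hG hfin
      obtain ⟨F, hFB, hF⟩ := Finset.subset_set_image_iff.1 (hfin.coe_toFinset.symm ▸ hG)
      obtain ⟨x, hx⟩ := hB F hFB y
      refine ⟨x, fun C hC => ?_⟩
      obtain ⟨m, hm, rfl⟩ := Finset.mem_image.1 (hF ▸ hfin.mem_toFinset.2 hC)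
      exact hx m hm)
  exact ⟨x, fun m hm => hx _ ⟨m, hm, rfl⟩⟩

end Coindependent

/-! ### Open maximal submodules, semisimple quotients and complements -/

section OpenCoatoms

variable (R M : Type*) [Ring R] [AddCommGroup M] [Module R M] [TopologicalSpace M]

/-- The open maximal submodules. -/
def openCoatoms : Set (Submodule R M) := {m | IsCoatom m ∧ IsOpen (m : Set M)}

variable {R M} [IsTopologicalAddGroup M]

/-- Otherwise each finite intersection, together with `N`, spans `M` and so meets a coset `x + N`
with `x ∉ N`; by compactness the zero submodule `sInf B` would meet it too. -/
theorem IsLinearlyCompactModule.exists_finset_inf_le (hM : IsLinearlyCompactModule R M)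
    {B : Set (Submodule R M)} (hcl : ∀ m ∈ B, IsClosed (m : Set M)) (hB : sInf B = ⊥)
    {N : Submodule R M} (hN : IsCoatom N) (hNo : IsOpen (N : Set M)) :
    ∃ F : Finset (Submodule R M), (F : Set (Submodule R M)) ⊆ B ∧ sInf (F : Set (Submodule R M)) ≤ N := by
  by_contra! hcon
  obtain ⟨x, hx⟩ : ∃ x, x ∉ N := by
    by_contra! h
    exact hN.1 (eq_top_iff.2 fun x _ => h x)
  obtain ⟨z, hz⟩ := hM.inter_nonempty
    (insert {y | y - x ∈ N} ((fun m : Submodule R M => {z | z - 0 ∈ m}) '' B))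
    (by
      rintro C (rfl | ⟨m, hm, rfl⟩)
      · exact ⟨Submodule.isClosed_coset (Submodule.isClosed_of_isOpen hNo) _, x, N, rfl⟩
      · exact ⟨Submodule.isClosed_coset (hcl m hm) _, 0, m, rfl⟩)
    (by
      intro G hG hfin
      have hG' : G \ {{y | y - x ∈ N}} ⊆ (fun m : Submodule R M => {z | z - 0 ∈ m}) '' B :=
        fun C hC => (hG hC.1).resolve_left hC.2
      obtain ⟨F, hFB, hF⟩ :=
        Finset.subset_set_image_iff.1 (hfin.sdiff.coe_toFinset.symm ▸ hG')
      have hnot := hcon F hFB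
      have htop : N ⊔ sInf (F : Set (Submodule R M)) = ⊤ := hN.2 _ (lt_of_le_of_ne le_sup_left fun he => hnot (by
        rw [he]; exact le_sup_right))
      obtain ⟨p, hp, k, hk, hpk⟩ :=
        Submodule.mem_sup.1 (htop ▸ Submodule.mem_top : x ∈ N ⊔ sInf (F : Set (Submodule R M)))
      refine ⟨k, fun C hC => ?_⟩
      by_cases hCe : C = {y | y - x ∈ N}
      · rw [hCe]
        change k - x ∈ N
        rw [← hpk]
        simpa using N.neg_mem hp
      · obtain ⟨m, hm, rfl⟩ := Finset.mem_image.1 (hF ▸ hfin.sdiff.mem_toFinset.2 ⟨hC, hCe⟩)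
        change k - 0 ∈ m
        simpa using (Submodule.mem_sInf.1 hk) m hm)
  have hz0 : z ∈ sInf B := by
    rw [Submodule.mem_sInf]
    intro m hm
    simpa using hz _ (Or.inr ⟨m, hm, rfl⟩)
  rw [hB, Submodule.mem_bot] at hz0
  have := hz _ (Or.inl rfl)
  subst hz0
  exact hx (by simpa using N.neg_mem this)

/-- In a finitely generated linearly compact module whose open maximal submodules intersect
trivially, all open submodules have semisimple quotients. -/
theorem IsLinearlyCompactModule.isSemisimpleModule_quotient (hM : IsLinearlyCompactModule R M)
    [Module.Finite R M] (h0 : sInf (openCoatoms R M) = ⊥) {N : Submodule R M}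
    (hN : IsOpen (N : Set M)) : IsSemisimpleModule R (M ⧸ N) := by
  classical
  obtain ⟨B, -, hBT, hBc, hB⟩ := Coindependent.exists_maximal (T := openCoatoms R M)
    (fun m hm => hm.1) Coindependent.empty (Set.empty_subset _)
  rw [h0] at hB
  have hcl : ∀ m ∈ B, IsClosed (m : Set M) := fun m hm => Submodule.isClosed_of_isOpen (hBT hm).2
  -- With `M` viewed as the product of the `M ⧸ m`, this is the coordinate axis of `m`: a simple
  -- complement of `m`.
  let S : Submodule R M → Submodule R M := fun m => sInf (B \ {m})
  have hdisj : ∀ m ∈ B, S m ⊓ m = ⊥ := by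
    intro m hm
    rw [eq_bot_iff, ← hB]
    refine le_sInf fun m' hm' => ?_
    by_cases he : m' = m
    · rw [he]; exact inf_le_right
    · exact inf_le_left.trans (sInf_le ⟨hm', he⟩)
  have hdec : ∀ F : Finset (Submodule R M), (F : Set (Submodule R M)) ⊆ B →
      sInf (F : Set (Submodule R M)) ⊔ ⨆ m ∈ F, S m = ⊤ := by
    intro F hF
    rw [eq_top_iff]
    intro x _
    have : ∀ m, ∃ s, m ∈ F → s ∈ S m ∧ s - x ∈ m := by
      intro m
      by_cases hm : m ∈ F
      · obtain ⟨s, hs⟩ := hBc.exists_forall_sub_mem hM hcl (fun m' => if m' = m then x else 0)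
        refine ⟨s, fun _ => ⟨?_, by simpa using hs m (hF hm)⟩⟩
        rw [Submodule.mem_sInf]
        rintro m' ⟨hm', hne⟩
        have hne' : m' ≠ m := hne
        simpa [hne'] using hs m' hm'
      · exact ⟨0, fun h => (hm h).elim⟩
    choose s hs using this
    rw [Submodule.mem_sup]
    refine ⟨x - ∑ m ∈ F, s m, ?_, ∑ m ∈ F, s m, ?_, by abel⟩
    · rw [Submodule.mem_sInf]
      intro m hm
      have hm' : m ∈ F := hm
      rw [← Finset.add_sum_erase F s hm', ← sub_sub]
      refine m.sub_mem (by simpa using m.neg_mem (hs m hm').2) (m.sum_mem fun m' hm'' => ?_)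
      have hne := Finset.mem_erase.1 hm''
      exact Submodule.mem_sInf.1 (hs m' hne.2).1 m ⟨hF hm, fun h => hne.1 h.symm⟩
    · exact Submodule.sum_mem _ fun m hm =>
        (le_iSup₂ (f := fun m (_ : m ∈ F) => S m) m hm) (hs m hm).1
  have hsimple : ∀ m ∈ B, IsSimpleModule R (S m) := by
    intro m hm
    have hcompl : IsCompl m (S m) := by
      refine ⟨disjoint_iff.2 (by rw [inf_comm]; exact hdisj m hm), codisjoint_iff.2 ?_⟩
      simpa using hdec {m} (by simpa using hm)
    have := isSimpleModule_iff_isCoatom.2 (hBT hm).1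
    exact IsSimpleModule.congr (Submodule.quotientEquivOfIsCompl m (S m) hcompl).symm
  let Soc : Submodule R M := ⨆ m ∈ B, S m
  have hSoc : IsSemisimpleModule R Soc :=
    isSemisimpleModule_biSup_of_isSemisimpleModule_submodule fun m hm => by
      have := hsimple m hm
      infer_instance
  -- If not, finite generation puts `N ⊔ Soc` inside a maximal submodule, open because it contains
  -- `N`. It then contains a finite intersection of members of `B` as well as the missing axes,
  -- which together span `M`.
  have htop : N ⊔ Soc = ⊤ := by
    by_contra hne
    obtain ⟨m, hm, hle⟩ := (eq_top_or_exists_le_coatom (N ⊔ Soc)).resolve_left hne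
    obtain ⟨F, hF, hFm⟩ := hM.exists_finset_inf_le hcl hB hm
      (Submodule.isOpen_of_le (le_sup_left.trans hle) hN)
    refine hm.1 (eq_top_iff.2 ((hdec F hF).ge.trans (sup_le hFm ?_)))
    refine le_trans ?_ (le_sup_right.trans hle)
    exact iSup₂_le fun m hm => le_iSup₂ (f := fun m (_ : m ∈ B) => S m) m (hF hm)
  refine IsSemisimpleModule.of_surjective (N.mkQ ∘ₗ Soc.subtype) fun q => ?_
  obtain ⟨x, rfl⟩ := N.mkQ_surjective q
  obtain ⟨n, hn, s, hs, rfl⟩ := Submodule.mem_sup.1 (htop ▸ Submodule.mem_top : x ∈ N ⊔ Soc)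
  exact ⟨⟨s, hs⟩, by simpa using hn⟩

/-- A closed `N` is the intersection of a coindependent family `A` of open maximal submodules.
Extend `A` to a coindependent `B` with zero intersection; the members of `B` outside `A` cut out a
complement. -/
theorem IsLinearlyCompactModule.closedSubmodulesComplemented (hM : IsLinearlyCompactModule R M)
    (hs : ∀ N : Submodule R M, IsOpen (N : Set M) → IsSemisimpleModule R (M ⧸ N)) :
    ClosedSubmodulesComplemented R M := by
  classical
  have := hM.linear
  have := hM.t2
  -- closed submodules are intersections of open maximal submodules
  have hclosed : ∀ N : Submodule R M, IsClosed (N : Set M) →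
      sInf {m ∈ openCoatoms R M | N ≤ m} = N := by
    intro N hN
    refine le_antisymm (fun x hx => ?_) (le_sInf fun m hm => hm.2)
    by_contra hxN
    have hU : (fun u => x - u) ⁻¹' (N : Set M)ᶜ ∈ 𝓝 (0 : M) :=
      (continuous_const.sub continuous_id).continuousAt.preimage_mem_nhds
        (by simpa using hN.isOpen_compl.mem_nhds hxN)
    obtain ⟨U, hUo, hUs⟩ := exists_open_submodule_subset (R := R) hU
    have hxNU : x ∉ N ⊔ U := by
      intro h
      obtain ⟨n, hn, v, hv, rfl⟩ := Submodule.mem_sup.1 h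
      exact hUs hv (by simpa using hn)
    have hNUo : IsOpen ((N ⊔ U : Submodule R M) : Set M) := Submodule.isOpen_of_le le_sup_right hUo
    have := hs _ hNUo
    have hjac : Module.jacobson R (M ⧸ (N ⊔ U)) = ⊥ := IsSemisimpleModule.jacobson_eq_bot R _
    have hx0 : (N ⊔ U).mkQ x ∉ Module.jacobson R (M ⧸ (N ⊔ U)) := by
      rw [hjac]; simpa using hxNU
    rw [Module.jacobson, Submodule.mem_sInf] at hx0
    push Not at hx0
    obtain ⟨m, hm, hxm⟩ := hx0
    have hle : N ⊔ U ≤ m.comap (N ⊔ U).mkQ := fun y hy => by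
      have : (N ⊔ U).mkQ y = 0 := by simpa using hy
      rw [Submodule.mem_comap, this]; exact m.zero_mem
    refine hxm (Submodule.mem_sInf.1 hx _ ⟨⟨?_, Submodule.isOpen_of_le hle hNUo⟩,
      le_sup_left.trans hle⟩)
    exact (Submodule.isCoatom_comap_iff (N ⊔ U).mkQ_surjective).2 hm
  intro N hN
  obtain ⟨A, -, hAT, hAc, hA⟩ := Coindependent.exists_maximal
    (T := {m ∈ openCoatoms R M | N ≤ m}) (fun m hm => hm.1.1) Coindependent.empty
    (Set.empty_subset _)
  obtain ⟨B, hAB, hBT, hBc, hB⟩ := Coindependent.exists_maximal (T := openCoatoms R M)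
    (fun m hm => hm.1) hAc (fun m hm => (hAT hm).1)
  rw [hclosed N hN] at hA
  have h0 : sInf (openCoatoms R M) = ⊥ := by
    simpa using hclosed ⊥ (by simp)
  rw [h0] at hB
  have hcl : ∀ m ∈ B, IsClosed (m : Set M) := fun m hm => Submodule.isClosed_of_isOpen (hBT hm).2
  refine ⟨sInf (B \ A), ?_, disjoint_iff.2 ?_, codisjoint_iff.2 (eq_top_iff.2 fun x _ => ?_)⟩
  · rw [Submodule.coe_sInf]
    exact isClosed_biInter fun m hm => hcl m hm.1
  · rw [← hA, ← sInf_union, Set.union_sdiff_cancel hAB, hB]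
  -- This `z` is the `N`-component of `x`: it vanishes along `A` and agrees with `x` along `B \ A`.
  · obtain ⟨z, hz⟩ := hBc.exists_forall_sub_mem hM hcl (fun m => if m ∈ A then 0 else x)
    rw [Submodule.mem_sup]
    refine ⟨z, ?_, x - z, ?_, by abel⟩
    · rw [← hA, Submodule.mem_sInf]
      intro m hm
      simpa [hm] using hz m (hAB hm)
    · rw [Submodule.mem_sInf]
      rintro m ⟨hm, hmA⟩
      have := hz m hm
      rw [if_neg hmA] at this
      simpa using m.neg_mem this

theorem ClosedSubmodulesComplemented.openSubmodulesComplemented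
    (h : ClosedSubmodulesComplemented R M) : OpenSubmodulesComplemented R M := fun N hN =>
  let ⟨N', _, hN'⟩ := h N (Submodule.isClosed_of_isOpen hN)
  ⟨N', hN'⟩

theorem OpenSubmodulesComplemented.isSemisimpleModule_quotient
    (h : OpenSubmodulesComplemented R M) {N : Submodule R M}
    (hN : IsOpen (N : Set M)) : IsSemisimpleModule R (M ⧸ N) where
  exists_isCompl Q := by
    have hle : N ≤ Q.comap N.mkQ := fun y hy => by
      have : N.mkQ y = 0 := by simpa using hy
      rw [Submodule.mem_comap, this]; exact Q.zero_mem
    obtain ⟨N', hN'⟩ := h (Q.comap N.mkQ) (Submodule.isOpen_of_le hle hN)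
    refine ⟨N'.map N.mkQ, disjoint_iff.2 (eq_bot_iff.2 ?_), codisjoint_iff.2 ?_⟩
    · rintro q ⟨hq, y, hy, rfl⟩
      have : y ∈ Q.comap N.mkQ ⊓ N' := ⟨hq, hy⟩
      rw [hN'.inf_eq_bot, Submodule.mem_bot] at this
      simp [this]
    · rw [← Submodule.map_comap_eq_of_surjective N.mkQ_surjective Q, ← Submodule.map_sup,
        hN'.sup_eq_top, Submodule.map_top, Submodule.range_mkQ]

end OpenCoatoms

/-! ### Products of discrete modules -/

section Products

theorem exists_finset_of_mem_nhds_pi {I : Type*} {X : I → Type*} [∀ i, Zero (X i)]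
    [∀ i, TopologicalSpace (X i)] [∀ i, DiscreteTopology (X i)] {U : Set (∀ i, X i)}
    (hU : U ∈ 𝓝 (0 : ∀ i, X i)) : ∃ F : Finset I, ∀ x : ∀ i, X i, (∀ i ∈ F, x i = 0) → x ∈ U := by
  rw [nhds_pi, Filter.mem_pi'] at hU
  obtain ⟨F, t, ht, hs⟩ := hU
  refine ⟨F, fun x hx => hs fun i hi => ?_⟩
  rw [hx i hi]
  exact mem_of_mem_nhds (ht i)

theorem isOpen_setOf_forall_mem_finset_eq_zero {I : Type*} {X : I → Type*} [∀ i, Zero (X i)]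
    [∀ i, TopologicalSpace (X i)] [∀ i, DiscreteTopology (X i)] (F : Finset I) :
    IsOpen {x : ∀ i, X i | ∀ i ∈ F, x i = 0} := by
  have : {x : ∀ i, X i | ∀ i ∈ F, x i = 0} = Set.pi (F : Set I) fun _ => {0} := by
    ext x; simp
  rw [this]
  exact isOpen_set_pi F.finite_toSet fun i _ => isOpen_discrete _

variable {R M M' : Type u} [Ring R] [TopologicalSpace R] [AddCommGroup M]
    [Module R M] [TopologicalSpace M] [AddCommGroup M'] [Module R M'] [TopologicalSpace M']

theorem IsProductOfSimpleDiscrete.of_equiv (e : M ≃L[R] M')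
    (h : IsProductOfSimpleDiscrete R M) : IsProductOfSimpleDiscrete R M' :=
  let ⟨I, S, h1, h2, ⟨φ⟩⟩ := h
  ⟨I, S, h1, h2, ⟨e.symm.trans φ⟩⟩

theorem IsProductOfIsotypicPowers.of_equiv (e : M ≃L[R] M')
    (h : IsProductOfIsotypicPowers R M) : IsProductOfIsotypicPowers R M' :=
  let ⟨I, S, n, h1, h2, h3, h4, ⟨φ⟩⟩ := h
  ⟨I, S, n, h1, h2, h3, h4, ⟨e.symm.trans φ⟩⟩

theorem IsProductOfIsotypicPowers.isProductOfSimpleDiscrete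
    (h : IsProductOfIsotypicPowers R M) : IsProductOfSimpleDiscrete R M := by
  obtain ⟨I, S, n, h1, h2, -, -, ⟨φ⟩⟩ := h
  refine ⟨Σ i, Fin (n i), fun p => S p.1, fun p => h1 p.1, fun p => h2 p.1, ⟨φ.trans ?_⟩⟩
  exact
    { toFun := fun x p => x p.1 p.2
      invFun := fun x i k => x ⟨i, k⟩
      map_add' := fun _ _ => rfl
      map_smul' := fun _ _ => rfl
      left_inv := fun _ => rfl
      right_inv := fun _ => rfl
      continuous_toFun := by fun_prop
      continuous_invFun := by fun_prop }

theorem IsProductOfSimpleDiscrete.t2Space (h : IsProductOfSimpleDiscrete R M) : T2Space M := by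
  obtain ⟨I, S, h1, h2, ⟨φ⟩⟩ := h
  exact φ.toHomeomorph.symm.t2Space

theorem IsProductOfSimpleDiscrete.isCompleteGroup [IsTopologicalAddGroup M]
    (h : IsProductOfSimpleDiscrete R M) : IsCompleteGroup M := by
  obtain ⟨I, S, h1, h2, ⟨φ⟩⟩ := h
  exact (IsCompleteGroup.pi fun i => IsCompleteGroup.of_discreteTopology).of_homeomorph
    φ.toLinearEquiv.toAddEquiv φ.toHomeomorph.isHomeomorph

theorem IsProductOfSimpleDiscrete.exists_isSemisimpleModule_quotient
    (h : IsProductOfSimpleDiscrete R M) {U : Set M} (hU : U ∈ 𝓝 (0 : M)) :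
    ∃ N : Submodule R M, IsOpen (N : Set M) ∧ (N : Set M) ⊆ U ∧ IsSemisimpleModule R (M ⧸ N) := by
  obtain ⟨I, S, h1, h2, ⟨φ⟩⟩ := h
  have hU' : φ.symm ⁻¹' U ∈ 𝓝 0 :=
    φ.symm.continuous.continuousAt.preimage_mem_nhds (by simpa using hU)
  obtain ⟨F, hF⟩ := exists_finset_of_mem_nhds_pi hU'
  let g : M →ₗ[R] (∀ i : F, S i) := LinearMap.pi fun i => (LinearMap.proj i.1) ∘ₗ φ.toLinearMap
  have hg : ∀ x, x ∈ LinearMap.ker g ↔ ∀ i ∈ F, φ x i = 0 := by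
    intro x
    rw [LinearMap.mem_ker, funext_iff]
    exact ⟨fun h i hi => h ⟨i, hi⟩, fun h i => h i.1 i.2⟩
  refine ⟨LinearMap.ker g, ?_, fun x hx => ?_, ?_⟩
  · have : (LinearMap.ker g : Set M) = φ ⁻¹' {x | ∀ i ∈ F, x i = 0} := by
      ext x; exact hg x
    rw [this]
    exact (isOpen_setOf_forall_mem_finset_eq_zero F).preimage φ.continuous
  · simpa using hF (φ x) ((hg x).1 hx)
  · exact IsSemisimpleModule.of_injective ((LinearMap.ker g).liftQ g le_rfl)
      (LinearMap.ker_eq_bot.1 (Submodule.ker_liftQ_eq_bot _ _ _ le_rfl))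

end Products

/-! ### Invariance under topological isomorphism -/

section Transport

variable {R M M' : Type*} [Ring R] [AddCommGroup M]
    [Module R M] [TopologicalSpace M] [AddCommGroup M'] [Module R M'] [TopologicalSpace M']

theorem IsPseudocompactModule.of_equiv [IsTopologicalAddGroup M] [IsTopologicalAddGroup M']
    (e : M ≃L[R] M') (h : IsPseudocompactModule R M) : IsPseudocompactModule R M' where
  t2 := have := h.t2; e.toHomeomorph.t2Space
  complete := h.complete.of_homeomorph e.symm.toLinearEquiv.toAddEquiv
    e.symm.toHomeomorph.isHomeomorph
  basis U hU := by
    have hU' : e ⁻¹' U ∈ 𝓝 0 := e.continuous.continuousAt.preimage_mem_nhds (by simpa using hU)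
    obtain ⟨N, ho, hl, hs⟩ := h.basis _ hU'
    refine ⟨N.map e.toLinearEquiv.toLinearMap, ?_, ?_, ?_⟩
    · exact e.toHomeomorph.isOpenMap _ ho
    · exact (Submodule.Quotient.equiv N _ e.toLinearEquiv rfl).isFiniteLength hl
    · rintro _ ⟨x, hx, rfl⟩
      exact hs hx

theorem OpenSubmodulesComplemented.of_equiv (e : M ≃L[R] M')
    (h : OpenSubmodulesComplemented R M) : OpenSubmodulesComplemented R M' := by
  intro N hN
  obtain ⟨N', hN'⟩ := h (N.comap e.toLinearEquiv.toLinearMap) (hN.preimage e.continuous)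
  refine ⟨N'.map e.toLinearEquiv.toLinearMap, ?_⟩
  have := (Submodule.orderIsoMapComap e.toLinearEquiv).isCompl hN'
  change IsCompl (Submodule.map e.toLinearEquiv.toLinearMap _) _ at this
  rwa [Submodule.map_comap_eq_of_surjective e.toLinearEquiv.surjective] at this

theorem ClosedSubmodulesComplemented.of_equiv (e : M ≃L[R] M')
    (h : ClosedSubmodulesComplemented R M) : ClosedSubmodulesComplemented R M' := by
  intro N hN
  obtain ⟨N', hc, hN'⟩ := h (N.comap e.toLinearEquiv.toLinearMap) (hN.preimage e.continuous)
  refine ⟨N'.map e.toLinearEquiv.toLinearMap, e.toHomeomorph.isClosedMap _ hc, ?_⟩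
  have := (Submodule.orderIsoMapComap e.toLinearEquiv).isCompl hN'
  change IsCompl (Submodule.map e.toLinearEquiv.toLinearMap _) _ at this
  rwa [Submodule.map_comap_eq_of_surjective e.toLinearEquiv.surjective] at this

end Transport

/-! ### The opposite ring and its radical -/

section Opposite

variable (R : Type u) [Ring R] [TopologicalSpace R]

/-- The right module `R` over itself is the left module `Rᵐᵒᵖ` over itself. -/
def opSelfEquiv : R ≃L[Rᵐᵒᵖ] Rᵐᵒᵖ where
  toFun := op
  invFun := unop
  map_add' _ _ := rfl
  map_smul' _ _ := rfl
  left_inv _ := rfl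
  right_inv _ := rfl
  continuous_toFun := continuous_op
  continuous_invFun := continuous_unop

variable {R}

theorem Ring.jacobson_op_eq_bot {R : Type*} [Ring R] (h : Ring.jacobson R = ⊥) :
    Ring.jacobson Rᵐᵒᵖ = ⊥ := by
  rw [eq_bot_iff] at h ⊢
  intro x hx
  rw [← Ideal.jacobson_bot, Ideal.mem_jacobson_iff] at hx
  have hr : ∀ y : R, ∃ z : R, (1 + unop x * y) * z = 1 := by
    intro y
    obtain ⟨z, hz⟩ := hx (op y)
    refine ⟨unop z, ?_⟩
    have : unop x * (y * unop z) + unop z = 1 :=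
      congrArg unop (sub_eq_zero.1 ((Submodule.mem_bot _).1 hz))
    rw [add_mul, one_mul, mul_assoc, add_comm, this]
  -- The right inverse `z` of `1 + xy` is `1 - xyz`, again of the form having a right inverse; hence
  -- `z` is two-sided.
  have hl : ∀ y : R, ∃ z : R, z * (1 + unop x * y) = 1 := by
    intro y
    obtain ⟨z, hz⟩ := hr y
    obtain ⟨w, hw⟩ := hr (-(y * z))
    have hz' : 1 + unop x * -(y * z) = z := by
      rw [← hz]; noncomm_ring
    rw [hz'] at hw
    have : w = 1 + unop x * y := by
      calc w = ((1 + unop x * y) * z) * w := by rw [hz, one_mul]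
        _ = _ := by rw [mul_assoc, hw, mul_one]
    exact ⟨z, this ▸ hw⟩
  have : unop x ∈ Ring.jacobson R := by
    rw [← Ideal.jacobson_bot, Ideal.mem_jacobson_iff]
    intro y
    obtain ⟨u, hu⟩ := hl y
    -- If `u(1 + xy) = 1`, then `1 - yux` is a left inverse of `1 + yx`.
    refine ⟨1 - y * u * unop x, (Submodule.mem_bot _).2 ?_⟩
    have : (1 - y * u * unop x) * y * unop x + (1 - y * u * unop x) - 1
        = y * unop x - y * (u * (1 + unop x * y)) * unop x := by noncomm_ring
    rw [this, hu, mul_one, sub_self]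
  exact unop_injective ((Submodule.mem_bot _).1 (h this))

end Opposite

/-! ### Prosemisimple rings -/

section Prosemisimple

/-- A complete Hausdorff topological ring with a neighbourhood basis of `0` consisting of
kernels of surjections onto semisimple rings. -/
structure IsProsemisimpleRing (R : Type u) [Ring R] [TopologicalSpace R] [IsTopologicalRing R] :
    Prop where
  t2 : T2Space R
  complete : IsCompleteGroup R
  basis : ∀ U ∈ 𝓝 (0 : R), ∃ (A : Type u) (_ : Ring A) (f : R →+* A), IsSemisimpleRing A ∧
    Function.Surjective f ∧ IsOpen (RingHom.ker f : Set R) ∧ (RingHom.ker f : Set R) ⊆ U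

/-- `R` and `R ⧸ I` induce the same submodules on `R ⧸ I`. -/
theorem isSemisimpleModule_quotient_iff {R : Type*} [Ring R] (I : Ideal R) [I.IsTwoSided] :
    IsSemisimpleModule R (R ⧸ I) ↔ IsSemisimpleRing (R ⧸ I) := by
  let e : (R ⧸ I) →ₛₗ[Ideal.Quotient.mk I] (R ⧸ I) :=
    { AddMonoidHom.id (R ⧸ I) with
      map_smul' := fun r x => by
        obtain ⟨x, rfl⟩ := Ideal.Quotient.mk_surjective x
        rfl }
  exact e.isSemisimpleModule_iff_of_bijective Function.bijective_id

theorem isSemisimpleModule_quotient_ker {R A : Type*} [Ring R] [Ring A] [IsSemisimpleRing A]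
    {f : R →+* A} (hf : Function.Surjective f) :
    IsSemisimpleModule R (R ⧸ RingHom.ker f) := by
  rw [isSemisimpleModule_quotient_iff]
  exact (RingHom.quotientKerEquivOfSurjective hf).symm.isSemisimpleRing

theorem isFiniteLength_of_isSemisimpleModule {R M : Type*} [Ring R] [AddCommGroup M] [Module R M]
    [Module.Finite R M] (h : IsSemisimpleModule R M) : IsFiniteLength R M :=
  isFiniteLength_iff_isNoetherian_isArtinian.2 ⟨inferInstance, inferInstance⟩

variable {R : Type u} [Ring R] [TopologicalSpace R] [IsTopologicalRing R]

theorem isCompleteGroup_op_iff : IsCompleteGroup Rᵐᵒᵖ ↔ IsCompleteGroup R :=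
  ⟨fun h => h.of_homeomorph opAddEquiv opHomeomorph.isHomeomorph,
    fun h => h.of_homeomorph opAddEquiv.symm opHomeomorph.symm.isHomeomorph⟩

namespace IsProsemisimpleRing

theorem op (h : IsProsemisimpleRing R) : IsProsemisimpleRing Rᵐᵒᵖ where
  t2 := have := h.t2; inferInstance
  complete := isCompleteGroup_op_iff.2 h.complete
  basis U hU := by
    obtain ⟨A, _, f, hA, hf, ho, hs⟩ := h.basis (MulOpposite.op ⁻¹' U)
      (continuous_op.continuousAt.preimage_mem_nhds (by simpa using hU))
    have hk : (RingHom.ker (RingHom.op f) : Set Rᵐᵒᵖ) = unop ⁻¹' (RingHom.ker f : Set R) := by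
      ext x
      change MulOpposite.op (f (unop x)) = 0 ↔ f (unop x) = 0
      simp
    refine ⟨Aᵐᵒᵖ, inferInstance, RingHom.op f, inferInstance, ?_, ?_, ?_⟩
    · intro a
      obtain ⟨r, hr⟩ := hf (unop a)
      exact ⟨MulOpposite.op r, congrArg MulOpposite.op hr⟩
    · rw [hk]; exact ho.preimage continuous_unop
    · rw [hk]
      intro x hx
      exact hs hx

theorem of_op (h : IsProsemisimpleRing Rᵐᵒᵖ) : IsProsemisimpleRing R where
  t2 := have := h.t2; opHomeomorph.symm.t2Space
  complete := isCompleteGroup_op_iff.1 h.complete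
  basis U hU := by
    obtain ⟨A, _, f, hA, hf, ho, hs⟩ := h.basis (unop ⁻¹' U)
      (continuous_unop.continuousAt.preimage_mem_nhds (by simpa using hU))
    let g : R →+* Aᵐᵒᵖ := (RingHom.op f).comp (RingEquiv.opOp R).toRingHom
    have hk : (RingHom.ker g : Set R) = MulOpposite.op ⁻¹' (RingHom.ker f : Set Rᵐᵒᵖ) := by
      ext x
      change MulOpposite.op (f (MulOpposite.op x)) = 0 ↔ f (MulOpposite.op x) = 0
      simp
    refine ⟨Aᵐᵒᵖ, inferInstance, g, inferInstance, ?_, ?_, ?_⟩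
    · intro a
      obtain ⟨r, hr⟩ := hf (unop a)
      exact ⟨unop r, congrArg MulOpposite.op hr⟩
    · rw [hk]; exact ho.preimage continuous_op
    · rw [hk]
      intro x hx
      exact hs hx

/-- A complete Hausdorff ring with sufficiently many open left ideals having semisimple quotients,
and in which right multiplications are equicontinuous, is prosemisimple. -/
theorem of_left_ideals (ht : T2Space R) (hc : IsCompleteGroup R)
    (hb : ∀ U ∈ 𝓝 (0 : R), ∃ V ∈ 𝓝 (0 : R), ∀ v ∈ V, ∀ r, v * r ∈ U)
    (hN : ∀ U ∈ 𝓝 (0 : R), ∃ N : Submodule R R, IsOpen (N : Set R) ∧ (N : Set R) ⊆ U ∧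
      IsSemisimpleModule R (R ⧸ N)) : IsProsemisimpleRing R where
  t2 := ht
  complete := hc
  basis U hU := by
    obtain ⟨N₁, ho₁, hs₁, -⟩ := hN U hU
    obtain ⟨V, hV, hVN⟩ := hb N₁ (ho₁.mem_nhds N₁.zero_mem)
    obtain ⟨N₂, ho₂, hs₂, hss⟩ := hN V hV
    -- The largest two-sided ideal inside `N₁`. It is open with semisimple quotient because
    -- equicontinuity makes it contain `N₂`.
    let I : Ideal R :=
      { carrier := {x | ∀ r, x * r ∈ N₁}
        add_mem' := fun hx hy r => by rw [add_mul]; exact N₁.add_mem (hx r) (hy r)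
        zero_mem' := fun r => by rw [zero_mul]; exact N₁.zero_mem
        smul_mem' := fun c x hx r => by
          rw [smul_eq_mul, mul_assoc]; exact N₁.smul_mem c (hx r) }
    have hI : I.IsTwoSided := ⟨fun b hx r => by rw [mul_assoc]; exact hx (b * r)⟩
    have hle : N₂ ≤ I := fun x hx r => hVN x (hs₂ hx) r
    have hIss : IsSemisimpleModule R (R ⧸ I) :=
      IsSemisimpleModule.of_surjective (Submodule.factor hle) (Submodule.factor_surjective hle)
    refine ⟨R ⧸ I, inferInstance, Ideal.Quotient.mk I, (isSemisimpleModule_quotient_iff I).1 hIss,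
      Ideal.Quotient.mk_surjective, ?_, ?_⟩
    · rw [Ideal.mk_ker]
      exact Submodule.isOpen_of_le hle ho₂
    · rw [Ideal.mk_ker]
      intro x hx
      exact hs₁ (by simpa using hx 1)

theorem of_right_ideals (ht : T2Space R) (hc : IsCompleteGroup R)
    (hb : ∀ U ∈ 𝓝 (0 : R), ∃ V ∈ 𝓝 (0 : R), ∀ v ∈ V, ∀ r, r * v ∈ U)
    (hN : ∀ U ∈ 𝓝 (0 : R), ∃ N : Submodule Rᵐᵒᵖ R, IsOpen (N : Set R) ∧ (N : Set R) ⊆ U ∧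
      IsSemisimpleModule Rᵐᵒᵖ (R ⧸ N)) : IsProsemisimpleRing R := by
  refine of_op (of_left_ideals inferInstance (isCompleteGroup_op_iff.2 hc) ?_ ?_)
  · intro U hU
    obtain ⟨V, hV, hVU⟩ := hb (MulOpposite.op ⁻¹' U)
      (continuous_op.continuousAt.preimage_mem_nhds (by simpa using hU))
    exact ⟨unop ⁻¹' V, continuous_unop.continuousAt.preimage_mem_nhds (by simpa using hV),
      fun v hv r => hVU (unop v) hv (unop r)⟩
  · intro U hU
    obtain ⟨N, ho, hs, hss⟩ := hN (MulOpposite.op ⁻¹' U)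
      (continuous_op.continuousAt.preimage_mem_nhds (by simpa using hU))
    refine ⟨N.map (opSelfEquiv R).toLinearEquiv.toLinearMap,
      (opSelfEquiv R).toHomeomorph.isOpenMap _ ho, ?_, ?_⟩
    · rintro _ ⟨x, hx, rfl⟩
      exact hs hx
    · exact IsSemisimpleModule.congr
        (Submodule.Quotient.equiv N _ (opSelfEquiv R).toLinearEquiv rfl).symm

theorem isProdiscreteRing (h : IsProsemisimpleRing R) : IsProdiscreteRing R where
  t2 := h.t2
  complete := h.complete
  basis U hU := by
    obtain ⟨A, _, f, hA, hf, ho, hs⟩ := h.basis U hU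
    have hk : (TwoSidedIdeal.ker f : Set R) = RingHom.ker f := by
      ext x; simp [TwoSidedIdeal.mem_ker]
    exact ⟨TwoSidedIdeal.ker f, hk ▸ ho, hk ▸ hs⟩

theorem exists_isSemisimpleModule_quotient (h : IsProsemisimpleRing R) {U : Set R}
    (hU : U ∈ 𝓝 (0 : R)) : ∃ N : Submodule R R, IsOpen (N : Set R) ∧ (N : Set R) ⊆ U ∧
      IsSemisimpleModule R (R ⧸ N) := by
  obtain ⟨A, _, f, hA, hf, ho, hs⟩ := h.basis U hU
  exact ⟨RingHom.ker f, ho, hs, isSemisimpleModule_quotient_ker hf⟩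

theorem isSemisimpleModule_quotient (h : IsProsemisimpleRing R) {N : Submodule R R}
    (hN : IsOpen (N : Set R)) : IsSemisimpleModule R (R ⧸ N) := by
  obtain ⟨N', -, hle, hss⟩ := h.exists_isSemisimpleModule_quotient (hN.mem_nhds N.zero_mem)
  exact IsSemisimpleModule.of_surjective (Submodule.factor hle) (Submodule.factor_surjective hle)

theorem isPseudocompactRing (h : IsProsemisimpleRing R) : IsPseudocompactRing R where
  t2 := h.t2
  complete := h.complete
  basis U hU := by
    obtain ⟨A, _, f, hA, hf, ho, hs⟩ := h.basis U hU
    have hf' : Function.Surjective (RingHom.op f) := fun a => by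
      obtain ⟨r, hr⟩ := hf (unop a)
      exact ⟨MulOpposite.op r, congrArg MulOpposite.op hr⟩
    let J : Submodule Rᵐᵒᵖ R :=
      Submodule.comap (opSelfEquiv R).toLinearEquiv.toLinearMap (RingHom.ker (RingHom.op f))
    have hmap : J.map (opSelfEquiv R).toLinearEquiv.toLinearMap = RingHom.ker (RingHom.op f) :=
      Submodule.map_comap_eq_of_surjective (opSelfEquiv R).toLinearEquiv.surjective _
    refine ⟨RingHom.ker f, J, ?_, ho, ?_, ?_, hs⟩
    · ext x
      change f x = 0 ↔ MulOpposite.op (f x) = 0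
      simp
    · exact isFiniteLength_of_isSemisimpleModule (isSemisimpleModule_quotient_ker hf)
    · exact (Submodule.Quotient.equiv J _ (opSelfEquiv R).toLinearEquiv hmap).symm.isFiniteLength
        (isFiniteLength_of_isSemisimpleModule (isSemisimpleModule_quotient_ker hf'))

theorem isLinearTopology_right (h : IsProsemisimpleRing R) : IsLinearTopology Rᵐᵒᵖ R :=
  h.isPseudocompactRing.right.isLinearTopology

theorem isLinearTopology_left (h : IsProsemisimpleRing R) : IsLinearTopology R R :=
  h.isPseudocompactRing.left.isLinearTopology

theorem isLinearlyCompactRing (h : IsProsemisimpleRing R) : IsLinearlyCompactRing R :=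
  ⟨h.isPseudocompactRing.left.isLinearlyCompactModule,
    h.isPseudocompactRing.right.isLinearlyCompactModule⟩

theorem closedSubmodulesComplemented (h : IsProsemisimpleRing R) :
    ClosedSubmodulesComplemented R R :=
  h.isLinearlyCompactRing.1.closedSubmodulesComplemented fun _ hN => h.isSemisimpleModule_quotient hN

/-- Semisimple quotient rings have zero radical, and their maximal left ideals pull back to open
maximal left ideals. -/
theorem topJacobson_eq_bot (h : IsProsemisimpleRing R) : topJacobson R = ⊥ := by
  have := h.t2
  rw [eq_bot_iff]
  intro x hx
  rw [Submodule.mem_bot]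
  by_contra hne
  obtain ⟨A, _, f, hA, hf, ho, hs⟩ := h.basis {x}ᶜ
    (isOpen_compl_singleton.mem_nhds (by simpa using Ne.symm hne))
  have hfx : f x ∉ Ring.jacobson A := by
    rw [IsSemisimpleRing.jacobson_eq_bot, Submodule.mem_bot]
    exact fun h0 => hs (show x ∈ RingHom.ker f from h0) rfl
  rw [Ring.jacobson_eq_sInf_isMaximal, Submodule.mem_sInf] at hfx
  push Not at hfx
  obtain ⟨m, hm, hxm⟩ := hfx
  have hm : Ideal.IsMaximal m := hm
  refine hxm (Submodule.mem_sInf.1 hx (Ideal.comap f m) ⟨Ideal.comap_isMaximal_of_surjective f hf, ?_⟩)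
  exact Submodule.isOpen_of_le (N := RingHom.ker f) (fun y hy => by
    have : f y = 0 := hy
    rw [Ideal.mem_comap, this]
    exact m.zero_mem) ho

end IsProsemisimpleRing

end Prosemisimple

/-! ### The Jacobson radical of a linearly compact ring -/

section Radical

variable {R : Type u} [Ring R] [TopologicalSpace R]

theorem sInf_openCoatoms : sInf (openCoatoms R R) = topJacobson R := by
  unfold openCoatoms topJacobson
  simp_rw [Ideal.isMaximal_def]

theorem jacobson_le_topJacobson : Ring.jacobson R ≤ topJacobson R := by
  rw [Ring.jacobson_eq_sInf_isMaximal]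
  exact sInf_le_sInf fun m hm => hm.1

theorem jacobson_eq_bot_of_topJacobson_eq_bot (h : topJacobson R = ⊥) : Ring.jacobson R = ⊥ :=
  eq_bot_iff.2 (jacobson_le_topJacobson.trans h.le)

variable [IsTopologicalRing R]

/-- For `z` in `J₀`, the element `1 - z` is left invertible modulo every open left ideal, since
otherwise an open maximal left ideal would contain both `z` and `1 - z`. Linear compactness glues
these into a true left inverse, so `1 - z` lies in no maximal left ideal. -/
theorem IsLinearlyCompactModule.topJacobson_le_jacobson (h : IsLinearlyCompactModule R R) :
    topJacobson R ≤ Ring.jacobson R := by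
  have := h.linear
  have := h.t2
  intro x hx
  rw [Ring.jacobson_eq_sInf_isMaximal, Submodule.mem_sInf]
  intro m hm
  have hm : Ideal.IsMaximal m := hm
  by_contra hxm
  obtain ⟨r, p, hp, hrp⟩ := hm.exists_inv hxm
  have hz : r * x ∈ topJacobson R := (topJacobson R).mul_mem_left r hx
  have hp1 : 1 - r * x ∈ m := by
    rw [← hrp]; simpa using hp
  generalize r * x = z at hz hp1
  let g : R →ₗ[R] R := LinearMap.toSpanSingleton R R (1 - z)
  have hgc : Continuous g := by
    change Continuous fun a : R => a * (1 - z)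
    fun_prop
  have hdense : ∀ N : Ideal R, IsOpen (N : Set R) → ∃ a, a * (1 - z) - 1 ∈ N := by
    intro N hN
    have htop : Ideal.span {1 - z} ⊔ N = ⊤ := by
      by_contra hne
      obtain ⟨m', hm', hle⟩ := Ideal.exists_le_maximal _ hne
      have hzm : z ∈ m' := Submodule.mem_sInf.1 hz m'
        ⟨hm', Submodule.isOpen_of_le (le_sup_right.trans hle) hN⟩
      have h1z : 1 - z ∈ m' := hle (le_sup_left (a := Ideal.span {1 - z})
        (Ideal.subset_span rfl))
      exact hm'.ne_top ((Ideal.eq_top_iff_one _).2 (by simpa using m'.add_mem h1z hzm))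
    obtain ⟨a, ha, n, hn, han⟩ := Submodule.mem_sup.1
      (htop ▸ Submodule.mem_top : (1 : R) ∈ Ideal.span {1 - z} ⊔ N)
    obtain ⟨b, rfl⟩ := Ideal.mem_span_singleton'.1 ha
    have hbn : b * (1 - z) - 1 = -n := by
      rw [sub_eq_iff_eq_add, neg_add_eq_sub, eq_sub_iff_add_eq]
      exact han
    exact ⟨b, hbn ▸ N.neg_mem hn⟩
  -- The left inverses of `1 - z` modulo an open `N` form a closed coset of the preimage of `N`
  -- under right multiplication by `1 - z`.
  obtain ⟨a, ha⟩ := h.inter_nonempty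
    {C | ∃ N : Ideal R, IsOpen (N : Set R) ∧ C = {a | a * (1 - z) - 1 ∈ N}}
    (by
      rintro C ⟨N, hN, rfl⟩
      refine ⟨(Submodule.isClosed_of_isOpen hN).preimage (by fun_prop), ?_⟩
      obtain ⟨a, ha⟩ := hdense N hN
      refine ⟨a, Submodule.comap g N, Set.ext fun b => ?_⟩
      change b * (1 - z) - 1 ∈ N ↔ (b - a) * (1 - z) ∈ N
      have : (b - a) * (1 - z) = (b * (1 - z) - 1) - (a * (1 - z) - 1) := by noncomm_ring
      rw [this]
      exact ⟨fun hb => N.sub_mem hb ha, fun hb => by simpa using N.add_mem hb ha⟩)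
    (by
      intro G hG hfin
      have : ∃ N : Ideal R, IsOpen (N : Set R) ∧ ∀ C ∈ G, {a | a * (1 - z) - 1 ∈ N} ⊆ C := by
        induction G, hfin using Set.Finite.induction_on with
        | empty => exact ⟨⊤, isOpen_univ, by simp⟩
        | insert _ _ ih =>
          obtain ⟨N, hN, hNG⟩ := ih fun C hC => hG (Or.inr hC)
          obtain ⟨N', hN', rfl⟩ := hG (Or.inl rfl)
          refine ⟨N ⊓ N', hN.inter hN', ?_⟩
          rintro C (rfl | hC) a ha
          · exact ha.2
          · exact hNG C hC ha.1
      obtain ⟨N, hN, hNG⟩ := this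
      obtain ⟨a, ha⟩ := hdense N hN
      exact ⟨a, fun C hC => hNG C hC ha⟩)
  have h1 : a * (1 - z) = 1 := by
    by_contra hne
    obtain ⟨N, hN, hNs⟩ := exists_open_submodule_subset (R := R)
      (isOpen_compl_singleton.mem_nhds (Ne.symm (sub_ne_zero.2 hne)) :
        {a * (1 - z) - 1}ᶜ ∈ 𝓝 (0 : R))
    exact hNs (show a * (1 - z) - 1 ∈ N from ha {a | a * (1 - z) - 1 ∈ N} ⟨N, hN, rfl⟩) rfl
  exact hm.ne_top ((Ideal.eq_top_iff_one _).2 (h1 ▸ Ideal.mul_mem_left m a hp1))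

/-- A left linearly compact ring with zero Jacobson radical in which right multiplications are
equicontinuous is prosemisimple. -/
theorem IsLinearlyCompactModule.isProsemisimpleRing (h : IsLinearlyCompactModule R R)
    (hb : ∀ U ∈ 𝓝 (0 : R), ∃ V ∈ 𝓝 (0 : R), ∀ v ∈ V, ∀ r, v * r ∈ U)
    (hJ : Ring.jacobson R = ⊥) : IsProsemisimpleRing R := by
  have := h.linear
  have h0 : sInf (openCoatoms R R) = ⊥ := by
    rw [sInf_openCoatoms, eq_bot_iff, ← hJ]
    exact h.topJacobson_le_jacobson
  refine .of_left_ideals h.t2 h.isCompleteGroup hb fun U hU => ?_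
  obtain ⟨N, hN, hs⟩ := exists_open_submodule_subset (R := R) hU
  exact ⟨N, hN, hs, h.isSemisimpleModule_quotient h0 hN⟩

theorem IsLinearTopology.exists_nhds_mul_mem_right [IsLinearTopology Rᵐᵒᵖ R] (U : Set R)
    (hU : U ∈ 𝓝 (0 : R)) : ∃ V ∈ 𝓝 (0 : R), ∀ v ∈ V, ∀ r, v * r ∈ U := by
  obtain ⟨N, hN, hs⟩ := exists_open_submodule_subset (R := Rᵐᵒᵖ) hU
  exact ⟨N, hN.mem_nhds N.zero_mem, fun v hv r => hs (N.smul_mem (op r) hv)⟩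

theorem IsLinearTopology.exists_nhds_mul_mem_left [IsLinearTopology R R] (U : Set R)
    (hU : U ∈ 𝓝 (0 : R)) : ∃ V ∈ 𝓝 (0 : R), ∀ v ∈ V, ∀ r, r * v ∈ U := by
  obtain ⟨N, hN, hs⟩ := exists_open_submodule_subset (R := R) hU
  exact ⟨N, hN.mem_nhds N.zero_mem, fun v hv r => hs (N.smul_mem r hv)⟩

theorem IsProdiscreteRing.isLinearTopology_left (h : IsProdiscreteRing R) :
    IsLinearTopology R R where
  hasBasis_submodule' := ⟨fun U => ⟨fun hU => by
    obtain ⟨I, ho, hs⟩ := h.basis U hU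
    exact ⟨I.asIdeal, ho.mem_nhds I.zero_mem, hs⟩, fun ⟨N, hN, hs⟩ => mem_of_superset hN hs⟩⟩

theorem IsProdiscreteRing.isLinearTopology_right (h : IsProdiscreteRing R) :
    IsLinearTopology Rᵐᵒᵖ R where
  hasBasis_submodule' := ⟨fun U => ⟨fun hU => by
    obtain ⟨I, ho, hs⟩ := h.basis U hU
    refine ⟨⟨⟨⟨(I : Set R), fun ha hb => I.add_mem ha hb⟩, I.zero_mem⟩,
      fun c x hx => I.mul_mem_right x (unop c) hx⟩, ho.mem_nhds I.zero_mem, hs⟩,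
    fun ⟨N, hN, hs⟩ => mem_of_superset hN hs⟩⟩

end Radical

/-! ### Recognising a product of discrete groups -/

section PiHomeomorph

variable {R : Type*} [AddCommGroup R] [TopologicalSpace R] [IsTopologicalAddGroup R]

theorem continuous_of_isOpen_ker {X : Type*} [AddCommGroup X] [TopologicalSpace X]
    [DiscreteTopology X] (f : R →+ X) (hf : IsOpen (f.ker : Set R)) : Continuous f := by
  refine continuous_of_continuousAt_zero f ?_
  rw [ContinuousAt, map_zero, nhds_discrete X, tendsto_pure]
  exact hf.mem_nhds (zero_mem f.ker)

/-- A group is topologically the product of a family of discrete quotients if the kernels are open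
and generate the neighbourhoods of zero, and all systems of congruences are solvable. -/
theorem isHomeomorph_pi_of_discrete [T2Space R] {I : Type*} {X : I → Type*}
    [∀ i, AddCommGroup (X i)] [∀ i, TopologicalSpace (X i)] [∀ i, DiscreteTopology (X i)]
    (f : ∀ i, R →+ X i) (ho : ∀ i, IsOpen ((f i).ker : Set R))
    (hb : ∀ U ∈ 𝓝 (0 : R), ∃ F : Finset I, ∀ x, (∀ i ∈ F, f i x = 0) → x ∈ U)
    (hs : ∀ y : ∀ i, X i, ∃ x, ∀ i, f i x = y i) :
    IsHomeomorph (fun x i => f i x : R → ∀ i, X i) := by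
  let g : R →+ ∀ i, X i := AddMonoidHom.mk' (fun x i => f i x) fun x y => by
    ext i; simp
  have hinj : Function.Injective g := by
    rw [injective_iff_map_eq_zero]
    intro x hx
    by_contra hne
    obtain ⟨F, hF⟩ := hb {x}ᶜ (isOpen_compl_singleton.mem_nhds (by simpa using Ne.symm hne))
    exact hF x (fun i _ => congrFun hx i) rfl
  have hsurj : Function.Surjective g := fun y => by
    obtain ⟨x, hx⟩ := hs y
    exact ⟨x, funext hx⟩
  let e : R ≃+ ∀ i, X i := AddEquiv.ofBijective g ⟨hinj, hsurj⟩
  have hcont : Continuous e := continuous_pi fun i => continuous_of_isOpen_ker (f i) (ho i)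
  have hcont' : Continuous e.symm := by
    refine continuous_of_continuousAt_zero e.symm ?_
    intro U hU
    rw [map_zero] at hU
    obtain ⟨F, hF⟩ := hb U hU
    rw [mem_map]
    refine mem_of_superset
      ((isOpen_setOf_forall_mem_finset_eq_zero F).mem_nhds (show (0 : ∀ i, X i) ∈ _ from
        fun i _ => rfl)) fun y hy => hF _ fun i hi => ?_
    have : f i (e.symm y) = y i := congrFun (e.apply_symm_apply y) i
    rw [this]
    exact hy i hi
  exact (Homeomorph.mk e.toEquiv hcont hcont').isHomeomorph

end PiHomeomorph

/-! ### Chinese remainder theorem for simple quotient rings -/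

section ChineseRemainder

variable {R : Type*} [Ring R]

/-- The image of `Q` is a nonzero two-sided ideal of a simple ring, hence the whole ring. -/
theorem exists_mem_map_eq_one_of_not_le_ker {A : Type*} [Ring A] [IsSimpleRing A] {f : R →+* A}
    (hf : Function.Surjective f) {Q : TwoSidedIdeal R} (hQ : ¬ Q ≤ TwoSidedIdeal.ker f) :
    ∃ x ∈ Q, f x = 1 := by
  let K : TwoSidedIdeal A := TwoSidedIdeal.mk' (f '' Q) ⟨0, Q.zero_mem, map_zero f⟩
    (by rintro _ _ ⟨x, hx, rfl⟩ ⟨y, hy, rfl⟩; exact ⟨x + y, Q.add_mem hx hy, map_add f x y⟩)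
    (by rintro _ ⟨x, hx, rfl⟩; exact ⟨-x, Q.neg_mem hx, map_neg f x⟩)
    (by
      rintro a _ ⟨y, hy, rfl⟩
      obtain ⟨x, rfl⟩ := hf a
      exact ⟨x * y, Q.mul_mem_left x y hy, map_mul f x y⟩)
    (by
      rintro _ b ⟨x, hx, rfl⟩
      obtain ⟨y, rfl⟩ := hf b
      exact ⟨x * y, Q.mul_mem_right x y hx, map_mul f x y⟩)
  have hK : ∀ a, a ∈ K ↔ a ∈ f '' Q := fun a => TwoSidedIdeal.mem_mk' _ _ _ _ _ _ _
  obtain h | h := eq_bot_or_eq_top K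
  · refine (hQ fun x hx => ?_).elim
    have : f x ∈ K := (hK _).2 ⟨x, hx, rfl⟩
    rw [h, TwoSidedIdeal.mem_bot] at this
    exact (TwoSidedIdeal.mem_ker _).2 this
  · have : (1 : A) ∈ K := h ▸ TwoSidedIdeal.mem_top A
    obtain ⟨x, hx, h1⟩ := (hK _).1 this
    exact ⟨x, hx, h1⟩

variable {I : Type*} {A : I → Type*} [∀ i, Ring (A i)] [∀ i, IsSimpleRing (A i)]
  {f : ∀ i, R →+* A i}

theorem exists_map_eq_one_and_forall_eq_zero (hf : ∀ i, Function.Surjective (f i))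
    (hne : ∀ i j, i ≠ j → TwoSidedIdeal.ker (f i) ≠ TwoSidedIdeal.ker (f j)) (i : I)
    (F : Finset I) (hi : i ∉ F) : ∃ x, f i x = 1 ∧ ∀ j ∈ F, f j x = 0 := by
  classical
  induction F using Finset.induction_on with
  | empty => exact ⟨1, map_one _, by simp⟩
  | insert j F hj ih =>
    simp only [Finset.mem_insert, not_or] at hi
    obtain ⟨x, hx1, hx⟩ := ih hi.2
    -- Kernels of surjections onto simple rings are maximal two-sided ideals, so distinct ones are
    -- incomparable.
    have hle : ¬ TwoSidedIdeal.ker (f j) ≤ TwoSidedIdeal.ker (f i) := by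
      intro hle
      have hle' : ¬ TwoSidedIdeal.ker (f i) ≤ TwoSidedIdeal.ker (f j) := fun h =>
        hne i j hi.1 (le_antisymm h hle)
      obtain ⟨y, hy, hy1⟩ := exists_mem_map_eq_one_of_not_le_ker (hf j) hle'
      have h1 : 1 - y ∈ TwoSidedIdeal.ker (f j) := by
        rw [TwoSidedIdeal.mem_ker, map_sub, map_one, hy1, sub_self]
      have h2 := hle h1
      rw [TwoSidedIdeal.mem_ker, map_sub, map_one, (TwoSidedIdeal.mem_ker _).1 hy, sub_zero] at h2
      exact one_ne_zero h2
    obtain ⟨y, hy, hy1⟩ := exists_mem_map_eq_one_of_not_le_ker (hf i) hle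
    refine ⟨x * y, by rw [map_mul, hx1, hy1, one_mul], fun k hk => ?_⟩
    obtain rfl | hk := Finset.mem_insert.1 hk
    · rw [map_mul, (TwoSidedIdeal.mem_ker _).1 hy, mul_zero]
    · rw [map_mul, hx k hk, zero_mul]

theorem exists_forall_mem_finset_map_eq (hf : ∀ i, Function.Surjective (f i))
    (hne : ∀ i j, i ≠ j → TwoSidedIdeal.ker (f i) ≠ TwoSidedIdeal.ker (f j))
    (F : Finset I) (y : ∀ i, A i) : ∃ x, ∀ i ∈ F, f i x = y i := by
  classical
  choose z hz using fun i => hf i (y i)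
  choose e he1 he using fun i => exists_map_eq_one_and_forall_eq_zero hf hne i (F.erase i) (by simp)
  refine ⟨∑ i ∈ F, z i * e i, fun i hi => ?_⟩
  rw [map_sum, Finset.sum_eq_single i]
  · rw [map_mul, hz, he1, mul_one]
  · intro j hj hji
    rw [map_mul, he j i (Finset.mem_erase.2 ⟨hji.symm, hi⟩), mul_zero]
  · exact fun h => (h hi).elim

end ChineseRemainder

/-! ### Decomposition into matrix rings -/

section Decomposition

variable {R : Type u} [Ring R] [TopologicalSpace R] [IsTopologicalRing R]

/-- A prosemisimple ring is topologically the product of its discrete simple Artinian quotient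
rings. -/
theorem IsProsemisimpleRing.exists_simple_quotients (h : IsProsemisimpleRing R) :
    ∃ (I : Type u) (A : I → Type u) (_ : ∀ i, Ring (A i)) (f : ∀ i, R →+* A i),
      (∀ i, IsSimpleRing (A i)) ∧ (∀ i, IsArtinianRing (A i)) ∧
      (∀ i, IsOpen (RingHom.ker (f i) : Set R)) ∧
      (∀ i j, i ≠ j → RingHom.ker (f i) ≠ RingHom.ker (f j)) ∧
      (∀ U ∈ 𝓝 (0 : R), ∃ F : Finset I, ∀ x, (∀ i ∈ F, f i x = 0) → x ∈ U) ∧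
      (∀ y : ∀ i, A i, ∃ x, ∀ i, f i x = y i) := by
  classical
  let I : Type u := {P : TwoSidedIdeal R // IsOpen (P : Set R) ∧
    IsSimpleRing P.ringCon.Quotient ∧ IsArtinianRing P.ringCon.Quotient}
  let A : I → Type u := fun P => P.1.ringCon.Quotient
  let f : ∀ i : I, R →+* A i := fun P => P.1.ringCon.mk'
  have hmem : ∀ (P : I) (x : R), f P x = 0 ↔ x ∈ P.1 := fun P x => by
    rw [← TwoSidedIdeal.mem_ker, TwoSidedIdeal.ker_ringCon_mk']
  have hker : ∀ P : I, (RingHom.ker (f P) : Set R) = P.1 := fun P => Set.ext fun x => hmem P x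
  have hsurj : ∀ P : I, Function.Surjective (f P) := fun P => P.1.ringCon.mk'_surjective
  have hsimple : ∀ P : I, IsSimpleRing (A P) := fun P => P.2.2.1
  refine ⟨I, A, inferInstance, f, hsimple, fun P => P.2.2.2, fun P => ?_, fun P Q hPQ hk => hPQ ?_,
    fun U hU => ?_, fun y => ?_⟩
  · rw [hker]; exact P.2.1
  · have : (P.1 : Set R) = Q.1 := by rw [← hker, hk, hker]
    exact Subtype.ext (SetLike.coe_injective this)
  · obtain ⟨B, _, g, hB, hg, ho, hs⟩ := h.basis U hU
    -- Wedderburn–Artin: the kernel of `g` is a finite intersection of kernels onto simple Artinian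
    -- rings, each an index in `I`.
    obtain ⟨n, D, d, _, hd, ⟨e⟩⟩ := IsSemisimpleRing.exists_ringEquiv_pi_matrix_divisionRing B
    let p : ∀ k, R →+* Matrix (Fin (d k)) (Fin (d k)) (D k) := fun k =>
      ((Pi.evalRingHom _ k).comp e.toRingHom).comp g
    have hp : ∀ k, Function.Surjective (p k) := fun k =>
      ((Function.surjective_eval k).comp e.surjective).comp hg
    have hle : ∀ k x, g x = 0 → p k x = 0 := fun k x hx => by
      change e (g x) k = 0
      rw [hx, map_zero]; rfl
    have heq : ∀ k, Nonempty ((TwoSidedIdeal.ker (p k)).ringCon.Quotient ≃+*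
        Matrix (Fin (d k)) (Fin (d k)) (D k)) := fun k =>
      ⟨RingCon.quotientKerEquivOfSurjective (p k) (hp k)⟩
    let P : Fin n → I := fun k => ⟨TwoSidedIdeal.ker (p k), by
      have := Submodule.isOpen_of_le (N := RingHom.ker g) (N' := RingHom.ker (p k))
        (fun x hx => hle k x hx) ho
      convert this using 1
      ext x; simp [TwoSidedIdeal.mem_ker], by
      obtain ⟨w⟩ := heq k
      exact IsSimpleRing.of_ringEquiv w.symm inferInstance, by
      obtain ⟨w⟩ := heq k
      exact w.symm.isArtinianRing⟩
    refine ⟨Finset.univ.image P, fun x hx => hs ?_⟩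
    change g x = 0
    apply e.injective
    rw [map_zero]
    funext k
    exact (TwoSidedIdeal.mem_ker _).1
      ((hmem (P k) x).1 (hx (P k) (Finset.mem_image_of_mem P (Finset.mem_univ k))))
  · have hne : ∀ P Q : I, P ≠ Q → TwoSidedIdeal.ker (f P) ≠ TwoSidedIdeal.ker (f Q) := by
      intro P Q hPQ hk
      rw [TwoSidedIdeal.ker_ringCon_mk', TwoSidedIdeal.ker_ringCon_mk'] at hk
      exact hPQ (Subtype.ext hk)
    choose z hz using fun P => hsurj P (y P)
    have hcos : ∀ P : I, {x | f P x = y P} = {x | x - z P ∈ RingHom.ker (f P)} := fun P => by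
      ext x
      rw [Set.mem_ofPred_eq, Set.mem_ofPred_eq, RingHom.mem_ker, map_sub, sub_eq_zero, hz]
    -- Linear compactness passes from finitely many congruences to all of them.
    obtain ⟨x, hx⟩ := h.isLinearlyCompactRing.1.inter_nonempty
      (Set.range fun P : I => {x | f P x = y P}) (by
        rintro _ ⟨P, rfl⟩
        dsimp only
        rw [hcos]
        refine ⟨Submodule.isClosed_coset (Submodule.isClosed_of_isOpen ?_) _, _, _, rfl⟩
        rw [hker]; exact P.2.1) (by
        intro G hG hfin
        rw [← Set.image_univ] at hG
        obtain ⟨F, -, hF⟩ := Finset.subset_set_image_iff.1 (hfin.coe_toFinset.symm ▸ hG)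
        obtain ⟨x, hx⟩ := exists_forall_mem_finset_map_eq hsurj hne F y
        refine ⟨x, fun C hC => ?_⟩
        obtain ⟨m, hm, rfl⟩ := Finset.mem_image.1 (hF ▸ hfin.mem_toFinset.2 hC)
        exact hx m hm)
    exact ⟨x, fun P => hx _ ⟨P, rfl⟩⟩

theorem IsProsemisimpleRing.isProductOfDiscreteMatrixRings (h : IsProsemisimpleRing R) :
    IsProductOfDiscreteMatrixRings R := by
  obtain ⟨I, A, _, f, hsimple, hart, ho, -, hb, hs⟩ := h.exists_simple_quotients
  have := h.t2
  choose n hn D hD w using fun i => IsSimpleRing.exists_ringEquiv_matrix_divisionRing (A i)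
  refine ⟨I, n, D, hD, fun i => Nat.one_le_iff_ne_zero.2 (hn i).1, ?_⟩
  let t : ∀ i, TopologicalSpace (Matrix (Fin (n i)) (Fin (n i)) (D i)) := fun _ => ⊥
  have hdisc : ∀ i, DiscreteTopology (Matrix (Fin (n i)) (Fin (n i)) (D i)) := fun _ => ⟨rfl⟩
  let g : ∀ i, R →+* Matrix (Fin (n i)) (Fin (n i)) (D i) := fun i =>
    (w i).some.toRingHom.comp (f i)
  have hg : ∀ i x, g i x = 0 ↔ f i x = 0 := fun i x =>
    map_eq_zero_iff (w i).some (w i).some.injective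
  have hhom : IsHomeomorph (RingHom.pi g) := isHomeomorph_pi_of_discrete
    (fun i => (g i).toAddMonoidHom)
    (fun i => by
      convert ho i using 1
      ext x
      exact hg i x)
    (fun U hU => by
      obtain ⟨F, hF⟩ := hb U hU
      exact ⟨F, fun x hx => hF x fun i hi => (hg i x).1 (hx i hi)⟩)
    (fun y => by
      obtain ⟨x, hx⟩ := hs fun i => (w i).some.symm (y i)
      refine ⟨x, fun i => ?_⟩
      change (w i).some (f i x) = y i
      rw [hx, RingEquiv.apply_symm_apply])
  exact ⟨RingEquiv.ofBijective (RingHom.pi g) hhom.bijective, hhom⟩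

theorem IsProductOfDiscreteMatrixRings.isProsemisimpleRing
    (h : IsProductOfDiscreteMatrixRings R) : IsProsemisimpleRing R := by
  obtain ⟨I, n, D, hD, hn, h⟩ := h
  let t : ∀ i, TopologicalSpace (Matrix (Fin (n i)) (Fin (n i)) (D i)) := fun _ => ⊥
  have hdisc : ∀ i, DiscreteTopology (Matrix (Fin (n i)) (Fin (n i)) (D i)) := fun _ => ⟨rfl⟩
  obtain ⟨e, he⟩ := h
  refine ⟨(he.homeomorph).symm.t2Space,
    (IsCompleteGroup.pi fun i => IsCompleteGroup.of_discreteTopology).of_homeomorph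
      e.toAddEquiv he, fun U hU => ?_⟩
  have hU' : he.homeomorph.symm ⁻¹' U ∈ 𝓝 0 :=
    he.homeomorph.symm.continuous.continuousAt.preimage_mem_nhds (by
      have : he.homeomorph.symm 0 = 0 := by
        rw [Homeomorph.symm_apply_eq]; exact (map_zero e).symm
      rwa [this])
  obtain ⟨F, hF⟩ := exists_finset_of_mem_nhds_pi hU'
  let f : R →+* ∀ i : F, Matrix (Fin (n i)) (Fin (n i)) (D i) :=
    (RingHom.pi fun i : F => Pi.evalRingHom _ i.1).comp e.toRingHom
  have hf : ∀ x, x ∈ RingHom.ker f ↔ ∀ i ∈ F, e x i = 0 := by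
    intro x
    rw [RingHom.mem_ker, funext_iff]
    exact ⟨fun h i hi => h ⟨i, hi⟩, fun h i => h i.1 i.2⟩
  refine ⟨∀ i : F, Matrix (Fin (n i)) (Fin (n i)) (D i), inferInstance, f, inferInstance, ?_, ?_,
    fun x hx => ?_⟩
  · classical
    intro y
    refine ⟨e.symm fun i => if hi : i ∈ F then y ⟨i, hi⟩ else 0, funext fun i => ?_⟩
    change e (e.symm _) i.1 = y i
    rw [RingEquiv.apply_symm_apply, dif_pos i.2]
  · have : (RingHom.ker f : Set R) = e ⁻¹' {x | ∀ i ∈ F, x i = 0} := by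
      ext x; exact hf x
    rw [this]
    exact (isOpen_setOf_forall_mem_finset_eq_zero F).preimage he.continuous
  · have := hF (e x) ((hf x).1 hx)
    change (he.homeomorph _).symm ((he.homeomorph _) x) ∈ U at this
    rwa [Homeomorph.symm_apply_apply] at this

end Decomposition

/-! ### Decomposition into isotypic powers -/

section Isotypic

variable {R : Type u} [Ring R] [TopologicalSpace R] [IsTopologicalRing R]

/-- A module over a discrete quotient ring, as a discrete topological module. -/
def TopModuleCat.discreteOfRingHom {A : Type u} [Ring A] (f : R →+* A)
    (hf : IsOpen (RingHom.ker f : Set R)) (S : Type u) [AddCommGroup S] [Module A S] :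
    TopModuleCat.{u} R :=
  letI : Module R S := Module.compHom S f
  letI : TopologicalSpace S := ⊥
  haveI : DiscreteTopology S := ⟨rfl⟩
  -- The action factors through `A`, and `f` is continuous for the discrete topology on `A` because
  -- its kernel is open.
  haveI : ContinuousSMul R S := ⟨by
    let : TopologicalSpace A := ⊥
    have : DiscreteTopology A := ⟨rfl⟩
    have hc : Continuous f := continuous_of_isOpen_ker f.toAddMonoidHom hf
    refine continuous_prod_of_discrete_right.2 fun s => ?_
    exact (continuous_of_discreteTopology (f := fun a : A => a • s)).comp hc⟩
  TopModuleCat.of R S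

theorem IsProsemisimpleRing.isProductOfIsotypicPowers (h : IsProsemisimpleRing R) :
    IsProductOfIsotypicPowers R R := by
  obtain ⟨I, A, _, f, hsimple, hart, ho, hne, hb, hs⟩ := h.exists_simple_quotients
  have := h.t2
  have hf : ∀ i, Function.Surjective (f i) := fun i a => by
    classical
    obtain ⟨x, hx⟩ := hs (Pi.single i a)
    exact ⟨x, by simpa using hx i⟩
  choose n hn S hS w using fun i => (IsSimpleRing.isIsotypic (A i) (A i)).linearEquiv_fun
  let T : I → TopModuleCat.{u} R := fun i => TopModuleCat.discreteOfRingHom (f i) (ho i) (S i)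
  let φ : ∀ i, A i ≃+ (Fin (n i) → T i) := fun i => (w i).some.toAddEquiv
  have hφ : ∀ i (r : R) (a : A i), φ i (f i r * a) = r • φ i a := fun i r a =>
    (w i).some.map_smul (f i r) a
  have hT : ∀ i, DiscreteTopology (T i) := fun i => ⟨rfl⟩
  -- The kernel of `f i` is the annihilator of `T i`, so distinct kernels force non-isomorphic
  -- modules.
  have hker : ∀ i (x : R), f i x = 0 ↔ ∀ t : T i, x • t = 0 := by
    intro i x
    refine ⟨fun hx t => ?_, fun hx => ?_⟩
    · change f i x • (show S i from t) = 0
      rw [hx, zero_smul]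
    · apply (φ i).injective
      have h1 := hφ i x 1
      rw [mul_one] at h1
      rw [h1, map_zero]
      funext k
      exact hx _
  refine ⟨I, T, n, hT, fun i => ?_, fun i j hij => ⟨fun e => hne i j hij ?_⟩,
    fun i => Nat.one_le_iff_ne_zero.2 (hn i).1, ?_⟩
  · have : RingHomSurjective (f i) := ⟨hf i⟩
    let e : T i →ₛₗ[f i] S i := { AddMonoidHom.id (S i) with map_smul' := fun _ _ => rfl }
    exact (e.isSimpleModule_iff_of_bijective Function.bijective_id).2 (hS i)
  · let e' := e.toContinuousLinearEquiv
    ext x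
    rw [RingHom.mem_ker, RingHom.mem_ker, hker, hker]
    refine ⟨fun hx t => ?_, fun hx t => ?_⟩
    · rw [← e'.apply_symm_apply t, ← map_smul, hx, map_zero]
    · rw [← e'.symm_apply_apply t, ← map_smul, hx, map_zero]
  · let g : ∀ i, R →+ (Fin (n i) → T i) := fun i =>
      (φ i).toAddMonoidHom.comp (f i).toAddMonoidHom
    have hg : ∀ i x, g i x = 0 ↔ f i x = 0 := fun i x =>
      map_eq_zero_iff (φ i) (φ i).injective
    have hhom : IsHomeomorph (fun x i => g i x) := isHomeomorph_pi_of_discrete g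
      (fun i => by
        convert ho i using 1
        ext x
        exact hg i x)
      (fun U hU => by
        obtain ⟨F, hF⟩ := hb U hU
        exact ⟨F, fun x hx => hF x fun i hi => (hg i x).1 (hx i hi)⟩)
      (fun y => by
        obtain ⟨x, hx⟩ := hs fun i => (φ i).symm (y i)
        refine ⟨x, fun i => ?_⟩
        change φ i (f i x) = y i
        rw [hx, AddEquiv.apply_symm_apply])
    let G : R →ₗ[R] ∀ i, Fin (n i) → T i :=
      { toFun := fun x i => g i x
        map_add' := fun x y => funext fun i => map_add (g i) x y
        map_smul' := fun r x => funext fun i => by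
          change φ i (f i (r * x)) = r • φ i (f i x)
          rw [map_mul, hφ] }
    let E : R ≃ₗ[R] ∀ i, Fin (n i) → T i := LinearEquiv.ofBijective G hhom.bijective
    exact ⟨ContinuousLinearEquiv.mk E hhom.continuous
      ((E.toEquiv.continuous_symm_iff).2 hhom.isOpenMap)⟩

end Isotypic

/-! ### Closed submodules and discrete modules of finite length -/

section PseudocompactModules

variable {R : Type*} [Ring R]

theorem IsPseudocompactModule.submodule {M : Type*} [AddCommGroup M] [Module R M]
    [TopologicalSpace M] [IsTopologicalAddGroup M] (h : IsPseudocompactModule R M)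
    (P : Submodule R M) (hP : IsClosed (P : Set M)) : IsPseudocompactModule R P where
  t2 := have := h.t2; inferInstance
  complete := h.complete.of_isInducing P.subtype.toAddMonoidHom IsInducing.subtypeVal (by
    convert hP using 1
    exact Subtype.range_coe)
  basis U hU := by
    rw [nhds_subtype_eq_comap, mem_comap] at hU
    obtain ⟨V, hV, hVU⟩ := hU
    obtain ⟨N, ho, hl, hs⟩ := h.basis V hV
    refine ⟨N.comap P.subtype, ho.preimage continuous_subtype_val, ?_, fun x hx => hVU (hs hx)⟩
    refine hl.of_injective (f := Submodule.mapQ (N.comap P.subtype) N P.subtype le_rfl) ?_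
    rw [← LinearMap.ker_eq_bot, Submodule.mapQ, Submodule.ker_liftQ_eq_bot]
    rw [LinearMap.ker_comp, Submodule.ker_mkQ]

theorem IsPseudocompactModule.of_discreteTopology {M : Type*} [AddCommGroup M] [Module R M]
    [TopologicalSpace M] [IsTopologicalAddGroup M] [DiscreteTopology M]
    (h : IsFiniteLength R M) : IsPseudocompactModule R M where
  t2 := inferInstance
  complete := .of_discreteTopology
  basis U hU := ⟨⊥, isOpen_discrete _, (Submodule.quotEquivOfEqBot ⊥ rfl).symm.isFiniteLength h, by
    rintro x rfl
    exact mem_of_mem_nhds hU⟩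

end PseudocompactModules

/-! ### Simple objects and their coproducts among pseudocompact modules -/

section SimpleObjects

variable {R : Type u} [Ring R] [TopologicalSpace R]

theorem PseudocompactCat.hom_ext {X Y : PseudocompactCat R} {f g : X ⟶ Y}
    (h : ∀ x, f.hom.hom x = g.hom.hom x) : f = g :=
  ObjectProperty.hom_ext _ (ConcreteCategory.hom_ext _ _ h)

/-- The morphism of pseudocompact modules given by a continuous linear map. -/
def PseudocompactCat.ofHom {X Y : PseudocompactCat R} (f : X.obj →L[R] Y.obj) : X ⟶ Y :=
  ObjectProperty.homMk (ConcreteCategory.ofHom f)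

theorem PseudocompactCat.ofHom_mono_of_injective {X Y : PseudocompactCat R} (f : X.obj →L[R] Y.obj)
    (hf : Function.Injective f) : Mono (PseudocompactCat.ofHom f) where
  right_cancellation _ _ e := PseudocompactCat.hom_ext fun x => hf
    (congrArg (fun k => k.hom.hom x) e)

/-- A closed submodule as a pseudocompact module. -/
def PseudocompactCat.sub (L : PseudocompactCat R) (P : Submodule R L.obj)
    (hP : IsClosed (P : Set L.obj)) : PseudocompactCat R :=
  ⟨TopModuleCat.of R P, L.property.submodule P hP⟩

/-- The inclusion of a closed submodule. -/
def PseudocompactCat.subι (L : PseudocompactCat R) (P : Submodule R L.obj)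
    (hP : IsClosed (P : Set L.obj)) : L.sub P hP ⟶ L :=
  PseudocompactCat.ofHom (X := L.sub P hP) P.subtypeL

instance (L : PseudocompactCat R) (P : Submodule R L.obj)
    (hP : IsClosed (P : Set L.obj)) : Mono (L.subι P hP) :=
  PseudocompactCat.ofHom_mono_of_injective (X := L.sub P hP) P.subtypeL Subtype.val_injective

theorem PseudocompactCat.eq_bot_or_eq_top_of_simple {L : PseudocompactCat R} [Simple L]
    (P : Submodule R L.obj) (hP : IsClosed (P : Set L.obj)) : P = ⊥ ∨ P = ⊤ := by
  by_cases h : L.subι P hP = 0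
  · left
    rw [eq_bot_iff]
    intro x hx
    exact congrArg (fun k => k.hom.hom (show (L.sub P hP).obj from ⟨x, hx⟩)) h
  · right
    have := isIso_of_mono_of_nonzero h
    rw [eq_top_iff]
    intro x _
    have h1 := congrArg (fun k => k.hom.hom x) (IsIso.inv_hom_id (L.subι P hP))
    have h2 : (L.subι P hP).hom.hom ((inv (L.subι P hP)).hom.hom x) = x := h1
    rw [← h2]
    exact Subtype.property (p := fun y => y ∈ P) _

theorem PseudocompactCat.nontrivial_of_simple (L : PseudocompactCat R) [Simple L] :
    Nontrivial L.obj := by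
  by_contra h
  rw [not_nontrivial_iff_subsingleton] at h
  exact id_nonzero L (PseudocompactCat.hom_ext fun x => Subsingleton.elim _ _)

/-- The kernel of a monomorphism into `S` is open, hence closed and itself pseudocompact, so it must
vanish. The source is therefore discrete, and a nonzero injection into a simple module is bijective.
-/
theorem PseudocompactCat.simple_of_discreteTopology (S : PseudocompactCat R)
    [DiscreteTopology S.obj] [IsSimpleModule R S.obj] : Simple S where
  mono_isIso_iff_nonzero {Y} f hf := by
    constructor
    · rintro hiso rfl
      have := IsSimpleModule.nontrivial R S.obj
      obtain ⟨s, hs⟩ := exists_ne (0 : S.obj)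
      have h1 := congrArg (fun k => k.hom.hom s) (IsIso.inv_hom_id (0 : Y ⟶ S))
      exact hs h1.symm
    · intro hne
      let g : Y.obj →ₗ[R] S.obj := f.hom.hom.toLinearMap
      have hgc : Continuous g := f.hom.hom.continuous
      have hko : IsOpen (LinearMap.ker g : Set Y.obj) := (isOpen_discrete {0}).preimage hgc
      have hk : LinearMap.ker g = ⊥ := by
        have hcl := Submodule.isClosed_of_isOpen hko
        have h0 : Y.subι _ hcl ≫ f = 0 ≫ f := PseudocompactCat.hom_ext fun x =>
          (LinearMap.mem_ker.1 (Subtype.property (p := fun y => y ∈ LinearMap.ker g) x)).trans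
            (map_zero f.hom.hom).symm
        have h1 := (cancel_mono f).1 h0
        rw [eq_bot_iff]
        intro x hx
        exact congrArg (fun k => k.hom.hom (show (Y.sub _ hcl).obj from ⟨x, hx⟩)) h1
      have hg0 : g ≠ 0 := fun h => hne (PseudocompactCat.hom_ext fun x => LinearMap.congr_fun h x)
      have hd : DiscreteTopology Y.obj := discreteTopology_of_isOpen_singleton_zero (by
        rw [hk] at hko; exact hko)
      let e : Y.obj ≃ₗ[R] S.obj :=
        LinearEquiv.ofBijective g ⟨LinearMap.ker_eq_bot.1 hk, LinearMap.surjective_of_ne_zero hg0⟩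
      let E : Y.obj ≃L[R] S.obj :=
        ⟨e, continuous_of_discreteTopology, continuous_of_discreteTopology⟩
      have : f = (ObjectProperty.isoMk _ (TopModuleCat.ofIso E)).hom :=
        PseudocompactCat.hom_ext fun x => rfl
      rw [this]
      infer_instance

/-- Finite-length discrete quotients of a coproduct of simple objects are semisimple. -/
theorem IsCoproductOfSimples.isSemisimpleModule_quotient {X : PseudocompactCat R}
    (h : IsCoproductOfSimples X) (N : Submodule R X.obj) (hN : IsOpen (N : Set X.obj))
    (hl : IsFiniteLength R (X.obj ⧸ N)) : IsSemisimpleModule R (X.obj ⧸ N) := by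
  obtain ⟨J, L, ι, hL, ⟨hc⟩⟩ := h
  let g : ∀ j, (L j).obj →ₗ[R] (X.obj ⧸ N) := fun j => N.mkQ ∘ₗ (ι j).hom.hom.toLinearMap
  -- The quotient by `N₀` is discrete of finite length and kills every `ι j`; the universal property
  -- makes it zero, so the images of the `L j` span `X.obj ⧸ N`.
  let N₀ : Submodule R X.obj := (⨆ j, LinearMap.range (g j)).comap N.mkQ
  have hle : N ≤ N₀ := fun x hx => by
    have : N.mkQ x = 0 := by simpa using hx
    rw [Submodule.mem_comap, this]; exact Submodule.zero_mem _
  have hN₀ : IsOpen (N₀ : Set X.obj) := Submodule.isOpen_of_le hle hN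
  have hd : DiscreteTopology (X.obj ⧸ N₀) :=
    QuotientAddGroup.discreteTopology (N := N₀.toAddSubgroup) hN₀
  let Q : PseudocompactCat R := ⟨TopModuleCat.of R (X.obj ⧸ N₀),
    .of_discreteTopology (hl.of_surjective (Submodule.factor_surjective hle))⟩
  let π : X ⟶ Q := PseudocompactCat.ofHom (Y := Q) ⟨N₀.mkQ, continuous_quot_mk⟩
  have hπ : π = 0 := Cofan.IsColimit.hom_ext hc _ _ fun j => PseudocompactCat.hom_ext fun x => by
    change N₀.mkQ ((ι j).hom.hom x) = 0
    rw [Submodule.mkQ_apply, Submodule.Quotient.mk_eq_zero]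
    exact (le_iSup (fun j => LinearMap.range (g j)) j) ⟨x, rfl⟩
  have htop : ⨆ j, LinearMap.range (g j) = ⊤ := by
    rw [eq_top_iff]
    intro q _
    obtain ⟨x, rfl⟩ := N.mkQ_surjective q
    have : N₀.mkQ x = 0 := congrArg (fun k => k.hom.hom x) hπ
    rw [Submodule.mkQ_apply, Submodule.Quotient.mk_eq_zero] at this
    exact this
  refine isSemisimpleModule_of_isSemisimpleModule_submodule' (fun j => ?_) htop
  have hko : IsOpen (LinearMap.ker (g j) : Set (L j).obj) := by
    have : (LinearMap.ker (g j) : Set (L j).obj) = (ι j).hom.hom ⁻¹' (N : Set X.obj) := by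
      ext x
      exact Submodule.Quotient.mk_eq_zero N
    rw [this]
    exact hN.preimage (ι j).hom.hom.continuous
  -- A categorically simple object controls only closed submodules. A zero kernel is open, so then
  -- `L j` is discrete and simple as a plain module; otherwise the image is zero.
  obtain hk | hk := PseudocompactCat.eq_bot_or_eq_top_of_simple _ (Submodule.isClosed_of_isOpen hko)
  · have hd : DiscreteTopology (L j).obj := discreteTopology_of_isOpen_singleton_zero (by
      rw [hk] at hko; exact hko)
    have := PseudocompactCat.nontrivial_of_simple (L j)
    have : IsSimpleModule R (L j).obj :=
      (isSimpleModule_iff R (L j).obj).2 ⟨fun P =>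
        PseudocompactCat.eq_bot_or_eq_top_of_simple P (isClosed_discrete _)⟩
    exact IsSemisimpleModule.range _
  · rw [LinearMap.ker_eq_top.1 hk, LinearMap.range_zero]
    exact { exists_isCompl := fun P => ⟨⊥, Subsingleton.elim ⊤ P ▸ isCompl_top_bot⟩ }

end SimpleObjects

/-! ### Products of isotypic powers as rings and as coproducts -/

section IsotypicPowers

/-- Finitely supported truncations of `x` converge to `x`, and `g` vanishes on each of them. -/
theorem map_eq_zero_of_forall_single {I : Type*} [DecidableEq I] {X : I → Type*}
    [∀ i, AddCommGroup (X i)] [∀ i, TopologicalSpace (X i)] [∀ i, DiscreteTopology (X i)]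
    {Y : Type*} [AddCommGroup Y] [TopologicalSpace Y] [T1Space Y] (g : (∀ i, X i) →+ Y)
    (hg : Continuous g) (x : ∀ i, X i) (hx : ∀ i, g (Pi.single i (x i)) = 0) : g x = 0 := by
  by_contra hne
  obtain ⟨F, hF⟩ := exists_finset_of_mem_nhds_pi (hg.continuousAt.preimage_mem_nhds
    (isOpen_compl_singleton.mem_nhds (by rw [map_zero]; exact Ne.symm hne) : {g x}ᶜ ∈ 𝓝 (g 0)))
  have := hF (x - ∑ i ∈ F, Pi.single i (x i)) fun i hi => by
    rw [Pi.sub_apply, Finset.sum_apply, Finset.sum_eq_single i]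
    · simp
    · intro j _ hji
      exact Pi.single_eq_of_ne hji.symm _
    · exact fun h => (h hi).elim
  apply this
  change g _ = g x
  rw [map_sub, map_sum, Finset.sum_eq_zero fun i _ => hx i, sub_zero]

variable {R : Type u} [Ring R] [TopologicalSpace R] {I : Type u}
  {S : I → TopModuleCat.{u} R} {n : I → ℕ} [∀ i, DiscreteTopology (S i)]

theorem exists_finset_coord_subset (φ : R ≃L[R] ∀ i, Fin (n i) → S i) {U : Set R}
    (hU : U ∈ 𝓝 (0 : R)) : ∃ F : Finset I, ∀ x, (∀ i ∈ F, φ x i = 0) → x ∈ U := by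
  obtain ⟨F, hF⟩ := exists_finset_of_mem_nhds_pi
    (φ.symm.continuous.continuousAt.preimage_mem_nhds (by simpa using hU) : φ.symm ⁻¹' U ∈ 𝓝 0)
  exact ⟨F, fun x hx => by simpa using hF (φ x) hx⟩

variable [∀ i, IsSimpleModule R (S i)]

/-- Acting on `t` is a continuous linear map from the product to `S i`. By Schur's lemma it kills
every factor with index other than `i`, so it depends only on the `i`-th coordinate. -/
theorem smul_eq_zero_of_coord_eq_zero (hS : ∀ i j, i ≠ j → IsEmpty (S i ≅ S j))
    (φ : R ≃L[R] ∀ i, Fin (n i) → S i) {i : I} {x : R} (hx : φ x i = 0) (t : S i) : x • t = 0 := by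
  classical
  let g : (∀ i, Fin (n i) → S i) →ₗ[R] S i :=
    LinearMap.toSpanSingleton R (S i) t ∘ₗ φ.symm.toLinearMap
  have hg : Continuous g := by
    change Continuous fun y => φ.symm y • t
    exact φ.symm.continuous.smul continuous_const
  have h0 : g (φ x) = 0 := by
    refine map_eq_zero_of_forall_single g.toAddMonoidHom hg (φ x) fun j => ?_
    change g _ = 0
    by_cases hji : j = i
    · subst hji
      rw [hx, Pi.single_zero, map_zero]
    · have hz : ∀ k, g ∘ₗ LinearMap.single R (fun i => Fin (n i) → S i) j ∘ₗ
          LinearMap.single R (fun _ => S j) k = 0 := fun k => by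
        refine (LinearMap.bijective_or_eq_zero _).resolve_left fun hb => ?_
        let e := LinearEquiv.ofBijective _ hb
        let E : S j ≃L[R] S i :=
          ⟨e, continuous_of_discreteTopology, continuous_of_discreteTopology⟩
        exact (hS j i hji).false (TopModuleCat.ofIso E)
      have hsum : φ x j = ∑ k, Pi.single k (φ x j k) := (Finset.univ_sum_single _).symm
      have : g ∘ₗ LinearMap.single R (fun i => Fin (n i) → S i) j = 0 :=
        LinearMap.pi_ext' hz
      exact LinearMap.congr_fun this (φ x j)
  change φ.symm (φ x) • t = 0 at h0
  rwa [φ.symm_apply_apply] at h0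

/-- Makes the basic neighbourhoods, given by vanishing of finitely many coordinates, two-sided
ideals. -/
theorem coord_mul_eq_zero (hS : ∀ i j, i ≠ j → IsEmpty (S i ≅ S j))
    (φ : R ≃L[R] ∀ i, Fin (n i) → S i) {i : I} {x : R} (hx : φ x i = 0) (r : R) :
    φ (x * r) i = 0 := by
  rw [← smul_eq_mul, map_smul]
  funext k
  exact smul_eq_zero_of_coord_eq_zero hS φ hx _

theorem IsProductOfIsotypicPowers.isProsemisimpleRing [IsTopologicalRing R]
    (h : IsProductOfIsotypicPowers R R) :
    IsProsemisimpleRing R := by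
  refine .of_left_ideals h.isProductOfSimpleDiscrete.t2Space
    h.isProductOfSimpleDiscrete.isCompleteGroup (fun U hU => ?_)
    fun U hU => h.isProductOfSimpleDiscrete.exists_isSemisimpleModule_quotient hU
  obtain ⟨I, S, n, h1, h2, hS, -, ⟨φ⟩⟩ := h
  obtain ⟨F, hF⟩ := exists_finset_coord_subset φ hU
  refine ⟨φ ⁻¹' {x | ∀ i ∈ F, x i = 0}, ?_, fun x hx r => hF _ fun i hi =>
    coord_mul_eq_zero hS φ (hx i hi) r⟩
  refine φ.continuous.continuousAt.preimage_mem_nhds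
    ((isOpen_setOf_forall_mem_finset_eq_zero F).mem_nhds ?_)
  simp

/-- The pseudocompact module given by a product of finite powers of non-isomorphic discrete
simple modules is their coproduct, provided it is free of rank one. -/
theorem IsProductOfIsotypicPowers.isCoproductOfSimples (h : IsProductOfIsotypicPowers R R)
    {X : PseudocompactCat R} (e : R ≃L[R] X.obj) : IsCoproductOfSimples X := by
  classical
  obtain ⟨I, S, n, h1, h2, hS, -, ⟨φ⟩⟩ := h
  let J : Type u := Σ i, Fin (n i)
  let L : J → PseudocompactCat R := fun p => ⟨S p.1, .of_discreteTopology
    (isFiniteLength_of_isSemisimpleModule inferInstance)⟩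
  let sg : ∀ p : J, S p.1 →L[R] (∀ i, Fin (n i) → S i) := fun p =>
    ⟨LinearMap.single R (fun i => Fin (n i) → S i) p.1 ∘ₗ LinearMap.single R (fun _ => S p.1) p.2,
      continuous_of_discreteTopology⟩
  let inc : ∀ p : J, S p.1 →L[R] R := fun p => φ.symm.toContinuousLinearMap.comp (sg p)
  let ι : ∀ p : J, L p ⟶ X := fun p =>
    PseudocompactCat.ofHom (X := L p) (e.toContinuousLinearMap.comp (inc p))
  have hinc : ∀ (p : J) (s : S p.1) (q : J),
      φ (inc p s) q.1 q.2 = if h : q = p then h ▸ s else 0 := by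
    intro p s q
    have h0 : φ (inc p s) = Pi.single p.1 (Pi.single p.2 s) := φ.apply_symm_apply _
    rw [h0]
    obtain ⟨i, k⟩ := p
    obtain ⟨j, l⟩ := q
    by_cases hji : j = i
    · subst hji
      by_cases hlk : l = k
      · subst hlk
        simp
      · rw [dif_neg (fun hh => hlk (by cases hh; rfl))]
        simp [hlk]
    · rw [dif_neg (fun hh => hji (congrArg Sigma.fst hh))]
      simp [hji]
  refine ⟨J, L, ι, fun p => ?_, ⟨?_⟩⟩
  · have : DiscreteTopology (L p).obj := h1 p.1
    have : IsSimpleModule R (L p).obj := h2 p.1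
    exact PseudocompactCat.simple_of_discreteTopology _
  -- the images of the coordinates of `1` are summable
  have hsum : ∀ (Y : PseudocompactCat R) (f : ∀ p, L p ⟶ Y),
      Summable fun p : J => (f p).hom.hom (φ 1 p.1 p.2) := by
    intro Y f
    let : UniformSpace Y.obj := IsTopologicalAddGroup.rightUniformSpace Y.obj
    have : IsUniformAddGroup Y.obj := isUniformAddGroup_of_addCommGroup
    have : CompleteSpace Y.obj := Y.property.complete
    have : NonarchimedeanAddGroup Y.obj := ⟨fun U hU => by
      obtain ⟨N, hN, -, hs⟩ := Y.property.basis U hU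
      exact ⟨⟨N.toAddSubgroup, hN⟩, hs⟩⟩
    refine NonarchimedeanAddGroup.summable_of_tendsto_cofinite_zero fun U hU => ?_
    obtain ⟨N, hN, hl, hs⟩ := Y.property.basis U hU
    have := (isFiniteLength_iff_isNoetherian_isArtinian.1 hl).1
    obtain ⟨T, hT⟩ : (⊤ : Submodule R (Y.obj ⧸ N)).FG := IsNoetherian.noetherian _
    choose lift hlift using fun q => N.mkQ_surjective q
    have hV : {r : R | ∀ q ∈ T, r • lift q ∈ N} ∈ 𝓝 (0 : R) := by
      have : {r : R | ∀ q ∈ T, r • lift q ∈ N} = ⋂ q ∈ T, (fun r => r • lift q) ⁻¹' N := by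
        ext r; simp
      rw [this, Filter.biInter_finset_mem]
      intro q _
      refine (continuous_id.smul continuous_const).continuousAt.preimage_mem_nhds ?_
      simpa using hN.mem_nhds N.zero_mem
    obtain ⟨F, hF⟩ := exists_finset_coord_subset φ hV
    -- The elements sent into `N` by the ideal of vanishing `F`-coordinates. It contains `N` and
    -- lifts of generators of `Y.obj ⧸ N`, so it is everything.
    let Q : Submodule R Y.obj :=
      { carrier := {y | ∀ x : R, (∀ i ∈ F, φ x i = 0) → x • y ∈ N}
        add_mem' := fun ha hb x hx => by rw [smul_add]; exact N.add_mem (ha x hx) (hb x hx)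
        zero_mem' := fun x _ => by rw [smul_zero]; exact N.zero_mem
        smul_mem' := fun c y hy x hx => by
          rw [smul_smul]
          exact hy _ fun i hi => coord_mul_eq_zero hS φ (hx i hi) c }
    have hNQ : N ≤ Q := fun y hy x _ => N.smul_mem x hy
    have hQ : ∀ y, y ∈ Q := by
      intro y
      have hle : (⊤ : Submodule R (Y.obj ⧸ N)) ≤ Q.map N.mkQ := by
        rw [← hT, Submodule.span_le]
        intro q hq
        exact ⟨lift q, fun x hx => hF x hx q hq, hlift q⟩
      obtain ⟨y', hy', hyy⟩ := hle (Submodule.mem_top (x := N.mkQ y))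
      have : y - y' ∈ N := by
        rwa [eq_comm, ← sub_eq_zero, ← map_sub, Submodule.mkQ_apply,
          Submodule.Quotient.mk_eq_zero] at hyy
      simpa using Q.add_mem (hNQ this) hy'
    rw [mem_map, mem_cofinite]
    refine (F.sigma fun i => (Finset.univ : Finset (Fin (n i)))).finite_toSet.subset fun p hp => ?_
    by_contra hpF
    have hpF' : p.1 ∉ F := by simpa using hpF
    apply hp
    apply hs
    -- The component of `1` at `p.1` fixes the `p`-th coordinate of `1`; for `p.1 ∉ F` its
    -- `F`-coordinates vanish, so it carries all of `Y` into `N`.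
    let ε : R := φ.symm (Pi.single p.1 (φ 1 p.1))
    have hε : φ ε = Pi.single p.1 (φ 1 p.1) := φ.apply_symm_apply _
    have hε1 : φ (1 - ε) p.1 = 0 := by
      rw [map_sub, hε, Pi.sub_apply, Pi.single_eq_same, sub_self]
    have h2 := smul_eq_zero_of_coord_eq_zero hS φ hε1 (φ 1 p.1 p.2)
    rw [sub_smul, one_smul, sub_eq_zero] at h2
    have h3 : (f p).hom.hom (φ 1 p.1 p.2) = ε • (f p).hom.hom (φ 1 p.1 p.2) :=
      (congrArg (f p).hom.hom h2).trans (map_smul (f p).hom.hom ε (φ 1 p.1 p.2))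
    change (f p).hom.hom (φ 1 p.1 p.2) ∈ N
    rw [h3]
    refine hQ _ ε fun i hi => ?_
    rw [hε]
    exact Pi.single_eq_of_ne (show i ≠ p.1 from fun hh => hpF' (hh ▸ hi)) _
  -- As `X` is free on the image of `1`, the descended map is determined by one value, the sum of
  -- the images of the coordinates of `1`.
  let desc : ∀ (Y : PseudocompactCat R) (_ : ∀ p, L p ⟶ Y), X ⟶ Y := fun Y f =>
    PseudocompactCat.ofHom
      ⟨LinearMap.toSpanSingleton R Y.obj (∑' p : J, (f p).hom.hom (φ 1 p.1 p.2)) ∘ₗ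
        e.symm.toLinearMap, e.symm.continuous.smul continuous_const⟩
  have hfac : ∀ (Y : PseudocompactCat R) (f : ∀ p, L p ⟶ Y) (p : J), ι p ≫ desc Y f = f p := by
    intro Y f p
    refine PseudocompactCat.hom_ext fun x => ?_
    have := Y.property.t2
    change e.symm (e (inc p x)) • (∑' q : J, (f q).hom.hom (φ 1 q.1 q.2)) = (f p).hom.hom x
    rw [e.symm_apply_apply]
    -- Multiplying the sum termwise by `inc p x` turns the coordinates of `1` into those of `inc p
    -- x`, of which only the `p`-th survives.
    have h3 := ((hsum Y f).hasSum.map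
      (DistribSMul.toAddMonoidHom Y.obj (inc p x)) (continuous_const_smul (inc p x)))
    refine h3.unique ?_
    have h4 : ∀ q : J, (DistribSMul.toAddMonoidHom Y.obj (inc p x))
        ((f q).hom.hom (φ 1 q.1 q.2)) = (f q).hom.hom (φ (inc p x) q.1 q.2) := by
      intro q
      have : φ (inc p x) = inc p x • φ 1 := by rw [← map_smul, smul_eq_mul, mul_one]
      rw [this]
      exact (map_smul (f q).hom.hom (inc p x) (φ 1 q.1 q.2)).symm
    have h5 := hasSum_single (f := fun q : J => (f q).hom.hom (φ (inc p x) q.1 q.2)) p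
      (fun q hq => by
        rw [hinc, dif_neg hq]
        exact map_zero (f q).hom.hom)
    have h6 : φ (inc p x) p.1 p.2 = x := by rw [hinc, dif_pos rfl]
    rw [h6] at h5
    convert h5 using 1
    exact funext h4
  have huniq : ∀ (Y : PseudocompactCat R) (m m' : X ⟶ Y), (∀ p, ι p ≫ m = ι p ≫ m') → m = m' := by
    intro Y m m' hm
    have := Y.property.t2
    let G : (∀ i, Fin (n i) → S i) →L[R] Y.obj :=
      (m.hom.hom - m'.hom.hom).comp (e.toContinuousLinearMap.comp φ.symm.toContinuousLinearMap)
    have hG : ∀ y, G y = 0 := fun y =>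
      map_eq_zero_of_forall_single G.toLinearMap.toAddMonoidHom G.continuous y fun i => by
        have : G.toLinearMap ∘ₗ LinearMap.single R (fun i => Fin (n i) → S i) i = 0 :=
          LinearMap.pi_ext' fun k => LinearMap.ext fun x =>
            sub_eq_zero.2 (congrArg (fun k => k.hom.hom x) (hm ⟨i, k⟩))
        exact LinearMap.congr_fun this (y i)
    refine PseudocompactCat.hom_ext fun x => sub_eq_zero.1 ?_
    have h7 : m.hom.hom (e (φ.symm (φ (e.symm x)))) - m'.hom.hom (e (φ.symm (φ (e.symm x)))) = 0 :=
      hG (φ (e.symm x))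
    rwa [φ.symm_apply_apply, e.apply_symm_apply] at h7
  exact Cofan.IsColimit.mk _ (fun s => desc s.pt s.inj) (fun s p => hfac s.pt s.inj p)
    fun s m hm => huniq _ _ _ fun p => (hm p).trans (hfac s.pt s.inj p).symm

end IsotypicPowers

/-! ### From the individual conditions to prosemisimplicity -/

section Converse

variable {R : Type u} [Ring R] [TopologicalSpace R] [IsTopologicalRing R]

theorem IsProductOfSimpleDiscrete.isProsemisimpleRing [IsLinearTopology Rᵐᵒᵖ R]
    (h : IsProductOfSimpleDiscrete R R) : IsProsemisimpleRing R :=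
  .of_left_ideals h.t2Space h.isCompleteGroup IsLinearTopology.exists_nhds_mul_mem_right
    fun _ hU => h.exists_isSemisimpleModule_quotient hU

theorem IsProductOfSimpleDiscrete.isProsemisimpleRing_of_right [IsLinearTopology R R]
    (h : IsProductOfSimpleDiscrete Rᵐᵒᵖ R) : IsProsemisimpleRing R :=
  .of_right_ideals h.t2Space h.isCompleteGroup IsLinearTopology.exists_nhds_mul_mem_left
    fun _ hU => h.exists_isSemisimpleModule_quotient hU

theorem IsProdiscreteRing.isProsemisimpleRing (h : IsProdiscreteRing R)
    (hc : OpenSubmodulesComplemented R R) : IsProsemisimpleRing R := by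
  have := h.isLinearTopology_left
  have := h.isLinearTopology_right
  refine .of_left_ideals h.t2 h.complete IsLinearTopology.exists_nhds_mul_mem_right fun U hU => ?_
  obtain ⟨N, hN, hs⟩ := exists_open_submodule_subset (R := R) hU
  exact ⟨N, hN, hs, hc.isSemisimpleModule_quotient hN⟩

theorem IsProdiscreteRing.isProsemisimpleRing_of_right (h : IsProdiscreteRing R)
    (hc : OpenSubmodulesComplemented Rᵐᵒᵖ R) : IsProsemisimpleRing R := by
  have := h.isLinearTopology_left
  have := h.isLinearTopology_right
  refine .of_right_ideals h.t2 h.complete IsLinearTopology.exists_nhds_mul_mem_left fun U hU => ?_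
  obtain ⟨N, hN, hs⟩ := exists_open_submodule_subset (R := Rᵐᵒᵖ) hU
  exact ⟨N, hN, hs, hc.isSemisimpleModule_quotient hN⟩

theorem IsPseudocompactRing.isProsemisimpleRing_of_coproduct (h : IsPseudocompactRing R)
    (hc : IsCoproductOfSimples (PseudocompactCat.of R R h.left)) : IsProsemisimpleRing R := by
  have := h.right.isLinearTopology
  refine .of_left_ideals h.t2 h.complete IsLinearTopology.exists_nhds_mul_mem_right fun U hU => ?_
  obtain ⟨N, hN, hl, hs⟩ := h.left.basis U hU
  exact ⟨N, hN, hs, hc.isSemisimpleModule_quotient N hN hl⟩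

theorem IsPseudocompactRing.isProsemisimpleRing_of_coproduct_right (h : IsPseudocompactRing R)
    (hc : IsCoproductOfSimples (PseudocompactCat.of Rᵐᵒᵖ R h.right)) : IsProsemisimpleRing R := by
  have := h.left.isLinearTopology
  refine .of_right_ideals h.t2 h.complete IsLinearTopology.exists_nhds_mul_mem_left fun U hU => ?_
  obtain ⟨N, hN, hl, hs⟩ := h.right.basis U hU
  exact ⟨N, hN, hs, hc.isSemisimpleModule_quotient N hN hl⟩

theorem IsPseudocompactModule.isProsemisimpleRing [IsLinearTopology Rᵐᵒᵖ R]
    (h : IsPseudocompactModule R R) (hJ : Ring.jacobson R = ⊥) : IsProsemisimpleRing R :=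
  h.isLinearlyCompactModule.isProsemisimpleRing IsLinearTopology.exists_nhds_mul_mem_right hJ

theorem IsPseudocompactModule.isProsemisimpleRing_of_right [IsLinearTopology R R]
    (h : IsPseudocompactModule Rᵐᵒᵖ R) (hJ : Ring.jacobson R = ⊥) : IsProsemisimpleRing R := by
  refine .of_op ((h.of_equiv (opSelfEquiv R)).isLinearlyCompactModule.isProsemisimpleRing
    (fun U hU => ?_) (Ring.jacobson_op_eq_bot hJ))
  obtain ⟨V, hV, hVU⟩ := IsLinearTopology.exists_nhds_mul_mem_left (R := R) (op ⁻¹' U)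
    (continuous_op.continuousAt.preimage_mem_nhds (by simpa using hU))
  exact ⟨unop ⁻¹' V, continuous_unop.continuousAt.preimage_mem_nhds (by simpa using hV),
    fun v hv r => hVU (unop v) hv (unop r)⟩

theorem IsLinearlyCompactRing.isProsemisimpleRing (h : IsLinearlyCompactRing R)
    (hJ : Ring.jacobson R = ⊥) : IsProsemisimpleRing R := by
  have := h.2.linear
  exact h.1.isProsemisimpleRing IsLinearTopology.exists_nhds_mul_mem_right hJ

end Converse

/-! ### The equivalences -/

theorem theorem3p10 (R : Type u) [Ring R] [TopologicalSpace R] [IsTopologicalRing R] :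
    List.TFAE [
      -- (a)
      IsProductOfIsotypicPowers R R,
      -- (b)
      ∃ h : IsPseudocompactRing R, IsCoproductOfSimples (PseudocompactCat.of R R h.left),
      -- (c)
      IsProductOfDiscreteMatrixRings R,
      -- (d), for open and for closed left ideals
      IsProdiscreteRing R ∧ OpenSubmodulesComplemented R R,
      IsProdiscreteRing R ∧ ClosedSubmodulesComplemented R R,
      -- (e), also with left pseudocompact semisimplicity as vanishing of the Jacobson radical
      IsLeftPseudocompactSemisimple R ∧ IsLinearTopology Rᵐᵒᵖ R,
      IsPseudocompactModule R R ∧ Ring.jacobson R = ⊥ ∧ IsLinearTopology Rᵐᵒᵖ R,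
      -- (f), for `J` and for `J₀`
      IsPseudocompactRing R ∧ Ring.jacobson R = ⊥,
      IsPseudocompactRing R ∧ topJacobson R = ⊥,
      -- (g), for `J` and for `J₀`
      IsLinearlyCompactRing R ∧ Ring.jacobson R = ⊥,
      IsLinearlyCompactRing R ∧ topJacobson R = ⊥,
      -- (h), the right-handed versions of (a), (b), (d), (e)
      IsProductOfIsotypicPowers Rᵐᵒᵖ R,
      ∃ h : IsPseudocompactRing R, IsCoproductOfSimples (PseudocompactCat.of Rᵐᵒᵖ R h.right),
      IsProdiscreteRing R ∧ OpenSubmodulesComplemented Rᵐᵒᵖ R,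
      IsProdiscreteRing R ∧ ClosedSubmodulesComplemented Rᵐᵒᵖ R,
      IsRightPseudocompactSemisimple R ∧ IsLinearTopology R R,
      IsPseudocompactModule Rᵐᵒᵖ R ∧ Ring.jacobson R = ⊥ ∧ IsLinearTopology R R] := by

  -- Statement (c) is the hub, entered and left through prosemisimplicity.
  tfae_have 1 → 3 := fun h => h.isProsemisimpleRing.isProductOfDiscreteMatrixRings
  tfae_have 2 → 3 := fun ⟨h, hc⟩ =>
    (h.isProsemisimpleRing_of_coproduct hc).isProductOfDiscreteMatrixRings
  tfae_have 3 → 1 := fun h => h.isProsemisimpleRing.isProductOfIsotypicPowers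
  tfae_have 3 → 2 := fun h => ⟨h.isProsemisimpleRing.isPseudocompactRing,
    h.isProsemisimpleRing.isProductOfIsotypicPowers.isCoproductOfSimples (.refl R R)⟩
  tfae_have 3 → 5 := fun h => ⟨h.isProsemisimpleRing.isProdiscreteRing,
    h.isProsemisimpleRing.closedSubmodulesComplemented⟩
  tfae_have 5 → 4 := fun h => ⟨h.1, h.2.openSubmodulesComplemented⟩
  tfae_have 4 → 3 := fun h => (h.1.isProsemisimpleRing h.2).isProductOfDiscreteMatrixRings
  tfae_have 3 → 6 := fun h =>
    ⟨h.isProsemisimpleRing.isProductOfIsotypicPowers.isProductOfSimpleDiscrete,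
      h.isProsemisimpleRing.isLinearTopology_right⟩
  tfae_have 6 → 3 := fun ⟨h, _⟩ =>
    (IsProductOfSimpleDiscrete.isProsemisimpleRing h).isProductOfDiscreteMatrixRings
  tfae_have 3 → 9 := fun h => ⟨h.isProsemisimpleRing.isPseudocompactRing,
    h.isProsemisimpleRing.topJacobson_eq_bot⟩
  tfae_have 9 → 8 := fun h => ⟨h.1, jacobson_eq_bot_of_topJacobson_eq_bot h.2⟩
  tfae_have 8 → 7 := fun h => ⟨h.1.left, h.2, h.1.right.isLinearTopology⟩
  tfae_have 7 → 3 := fun ⟨h, hJ, _⟩ => (h.isProsemisimpleRing hJ).isProductOfDiscreteMatrixRings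
  tfae_have 3 → 11 := fun h => ⟨h.isProsemisimpleRing.isLinearlyCompactRing,
    h.isProsemisimpleRing.topJacobson_eq_bot⟩
  tfae_have 11 → 10 := fun h => ⟨h.1, jacobson_eq_bot_of_topJacobson_eq_bot h.2⟩
  tfae_have 10 → 3 := fun h => (h.1.isProsemisimpleRing h.2).isProductOfDiscreteMatrixRings
  tfae_have 12 → 3 := fun h => (IsProsemisimpleRing.of_op
    (h.of_equiv (opSelfEquiv R)).isProsemisimpleRing).isProductOfDiscreteMatrixRings
  tfae_have 3 → 12 := fun h =>
    h.isProsemisimpleRing.op.isProductOfIsotypicPowers.of_equiv (opSelfEquiv R).symm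
  tfae_have 13 → 3 := fun ⟨h, hc⟩ =>
    (h.isProsemisimpleRing_of_coproduct_right hc).isProductOfDiscreteMatrixRings
  tfae_have 3 → 13 := fun h => ⟨h.isProsemisimpleRing.isPseudocompactRing,
    h.isProsemisimpleRing.op.isProductOfIsotypicPowers.isCoproductOfSimples (opSelfEquiv R).symm⟩
  tfae_have 3 → 15 := fun h => ⟨h.isProsemisimpleRing.isProdiscreteRing,
    h.isProsemisimpleRing.op.closedSubmodulesComplemented.of_equiv (opSelfEquiv R).symm⟩
  tfae_have 15 → 14 := fun h => ⟨h.1, h.2.openSubmodulesComplemented⟩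
  tfae_have 14 → 3 := fun h => (h.1.isProsemisimpleRing_of_right h.2).isProductOfDiscreteMatrixRings
  tfae_have 12 → 16 := fun h => ⟨h.isProductOfSimpleDiscrete,
    (IsProsemisimpleRing.of_op
      (h.of_equiv (opSelfEquiv R)).isProsemisimpleRing).isLinearTopology_left⟩
  tfae_have 16 → 3 := fun ⟨h, _⟩ =>
    (IsProductOfSimpleDiscrete.isProsemisimpleRing_of_right h).isProductOfDiscreteMatrixRings
  tfae_have 8 → 17 := fun h => ⟨h.1.right, h.2, h.1.left.isLinearTopology⟩
  tfae_have 17 → 3 := fun ⟨h, hJ, _⟩ =>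
    (h.isProsemisimpleRing_of_right hJ).isProductOfDiscreteMatrixRings
  tfae_finish
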